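/- Let $X$ be a complete (possibly singular) integral curve over $\mathbb C$, let $P\neq Q$ be smooth closed points of $X$, let $K$ be the function field of $X$, $n$ a natural number, and $\widehat D_s=\operatorname{Spec}\mathbb C[\![s]\!]$. **Opers.** A *local affine $\mathrm{GL}_n$-oper* on $(X,P)$ is a pair $(\widehat{\mathcal E},\widehat\nabla)$: a formal torsion-free sheaf $\widehat{\mathcal E}=\widehat{\mathcal E}_0$ of rank $n$ on $X\times\widehat D_s$ (a formal deformation of a torsion-free coherent sheaf on $X$) with a parabolic structure $\widehat{\mathcal E}_0\subset\widehat{\mathcal E}_1\subset\cdots\subset\widehat{\mathcal E}_n=\widehat{\mathcal E}_0(P)$, continued to all $i\in\mathbb Z$ by $\widehat{\mathcal E}_{i+n}=\widehat{\mathcal E}_i(P)$, and an additive map $\widehat\nabla$ on $\varinjlim\widehat{\mathcal E}_i$ with $\widehat\nabla(gv)=g\widehat\nabla v+\frac{\partial g}{\partial s}v$, such that for all $i$: $\widehat{\mathcal E}_{i+1}/\widehat{\mathcal E}_i$ is invertible on $P\times\widehat D_s$ and $\chi(\widehat{\mathcal E}_{i+1})=\chi(\widehat{\mathcal E}_i)+1$;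 $\widehat\nabla(\widehat{\mathcal E}_i)\subset\widehat{\mathcal E}_{i+1}$ and $\widehat\nabla$ raises the order at $P$ by exactly one; and $\widehat\nabla$ induces isomorphisms $\operatorname{gr}_i\to\operatorname{gr}_{i+1}$. Here $\chi$ is the Euler characteristic of the restriction to $s=0$. A *local affine Miura $\mathrm{GL}_n$-oper* is such an oper with a second parabolic structure $\widehat{\mathcal E}=\widehat{\mathcal E}'_0\subset\widehat{\mathcal E}'_1\subset\cdots\subset\widehat{\mathcal E}'_n=\widehat{\mathcal E}(Q)$, with $\widehat{\mathcal E}'_i/\widehat{\mathcal E}'_{i-1}$ invertible on $Q\times\widehat D_s$, preserved by $\widehat\nabla$ (acting on sections with arbitrary poles at $P$). Write $E_i$, $E'_i$ for the restrictions of $\widehat{\mathcal E}_i$, $\widehat{\mathcal E}'_i$ to $s=0$, and $E=E_0$. **Krichever map.** Let $f\in K$ be a local parameter at $P$. A Krichever trivialization is an isomorphism $\varphi$ from the completion at $P$ of the generic fibre of $E$ onto $\mathbb C(\!(t)\!)$, linear over $\mathbb C(\!(f)\!)=\mathbb C(\!(t^n)\!)$, $f=t^n$, which for every $i$ maps the completed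 stalk of $E_i$ at $P$ onto $t^{1-\chi(E_i)}\mathbb C[\![t]\!]$ (no compatibility with $\widehat\nabla$ is required of it). The Krichever image of the oper is $W=\varphi\big(H^0(X\setminus P,E)\big)\subset\mathbb C(\!(t)\!)$. **Grassmannian and flags.** $\mathcal{GR}^{(n)}$ is the set of subspaces $W\subset\mathbb C(\!(t)\!)$ such that $\gamma_W\colon W\to\mathbb C(\!(t)\!)/t\mathbb C[\![t]\!]$ has finite-dimensional kernel and cokernel and $t^{-n}W\subset W$; $\operatorname{virtdim}W=\dim\ker\gamma_W-\dim\operatorname{coker}\gamma_W$. $\mathcal{FL}^{(n)}$ is the set of chains $W_0\subset W_1\subset\cdots\subset W_n$ of elements of $\mathcal{GR}^{(n)}$ with $\operatorname{virtdim}W_i=i-n$ and $t^{-n}W_n=W_0$. **Proposition.** Given a local affine Miura $\mathrm{GL}_n$-oper on $(X,P,Q)$ and a Krichever trivialization of the associated local affine $\mathrm{GL}_n$-oper, suppose that the Krichever image $W$ is $n$-reduced, i.e. $t^{-n}W\subset W$, and that the coordinate is adapted to $Q$, i.e. the rational function $f^{-1}$ (which is $t^{-n}$) is regular and vanishes at $Q$.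 Then $W\in\mathcal{GR}^{(n)}$, and the pair consisting of $W$ and the flag $\widehat{\mathcal E}'_1/\widehat{\mathcal E}'\subset\cdots\subset\widehat{\mathcal E}'_n/\widehat{\mathcal E}'$ (at $s=0$) defines a point of $\mathcal{FL}^{(n)}$: there is exactly one $(W_0\subset\cdots\subset W_n)\in\mathcal{FL}^{(n)}$ with $W_n=W$ for which the following holds. For every $v\in H^0(X\setminus P,E'_n)$ one has $t^{-n}\varphi(v)\in W_n$, and there is an isomorphism $\theta\colon W_n/W_0\to E'_n/E'_0$ (a skyscraper at $Q$) that sends the class of $t^{-n}\varphi(v)$ to the class of $v$ for all such $v$, and maps $W_i/W_0$ onto $E'_i/E'_0$ for all $i$. -/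

import Mathlib

open AlgebraicGeometry CategoryTheory
open scoped PowerSeries

noncomputable section

namespace AffineMiura

/-! ## Sato Grassmannian and affine flag variety -/

/-- The field `ℂ((t))` of formal Laurent series.  (A type of its own, so that its ring structure and
its structure of a complex vector space are found in one way only.) -/
def Laurent : Type := HahnSeries ℤ ℂ

instance : CommRing Laurent := inferInstanceAs (CommRing (HahnSeries ℤ ℂ))

instance : Algebra ℂ Laurent := HahnSeries.C.toAlgebra (R := ℂ) (S := HahnSeries ℤ ℂ)

/-- The coefficient of `t ^ k`. -/
def Laurent.coeff (g : Laurent) (k : ℤ) : ℂ := HahnSeries.coeff (Γ := ℤ) (R := ℂ) g k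

/-- The monomial `t ^ m`. -/
def tMonomial (m : ℤ) : Laurent := HahnSeries.single (Γ := ℤ) (R := ℂ) m 1

theorem Laurent.coeff_smul (c : ℂ) (g : Laurent) (k : ℤ) : (c • g).coeff k = c * g.coeff k := by
  rw [Algebra.smul_def]
  exact HahnSeries.coeff_single_zero_mul (Γ := ℤ) (R := ℂ)

/-- Multiplication by `t ^ m` on `ℂ((t))`. -/
def tPow (m : ℤ) : Laurent →ₗ[ℂ] Laurent := LinearMap.mulLeft ℂ (tMonomial m)

/-- The subspace `t ^ m ℂ[[t]]` of `ℂ((t))`. -/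
def tLattice (m : ℤ) : Submodule ℂ Laurent where
  carrier := {g | ∀ k < m, g.coeff k = 0}
  zero_mem' := fun k _ => HahnSeries.coeff_zero (Γ := ℤ) (R := ℂ) (a := k)
  add_mem' := by
    intro a b ha hb k hk
    have h : (a + b).coeff k = a.coeff k + b.coeff k :=
      HahnSeries.coeff_add (Γ := ℤ) (R := ℂ) (x := a) (y := b) (a := k)
    rw [h, ha k hk, hb k hk, add_zero]
  smul_mem' := by
    intro c a ha k hk
    rw [Laurent.coeff_smul, ha k hk, mul_zero]

/-- The projection `γ_W : W → ℂ((t)) / t ℂ[[t]]`. -/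
def gammaMap (W : Submodule ℂ Laurent) : W →ₗ[ℂ] (Laurent ⧸ tLattice 1) :=
  (tLattice 1).mkQ ∘ₗ W.subtype

/-- The projection `γ_W` has finite-dimensional kernel and cokernel. -/
def IsFredholm (W : Submodule ℂ Laurent) : Prop :=
  FiniteDimensional ℂ (LinearMap.ker (gammaMap W)) ∧
    FiniteDimensional ℂ ((Laurent ⧸ tLattice 1) ⧸ LinearMap.range (gammaMap W))

/-- The virtual dimension of `W`, the index of `γ_W`. -/
def virtDim (W : Submodule ℂ Laurent) : ℤ :=
  (Module.finrank ℂ (LinearMap.ker (gammaMap W)) : ℤ) -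
    Module.finrank ℂ ((Laurent ⧸ tLattice 1) ⧸ LinearMap.range (gammaMap W))

/-- The Sato Grassmannian. -/
def SatoGr : Set (Submodule ℂ Laurent) := {W | IsFredholm W}

/-- The `n`-reduced Sato Grassmannian: `t ^ (-n) W ⊆ W`. -/
def ReducedGr (n : ℕ) : Set (Submodule ℂ Laurent) :=
  {W | W ∈ SatoGr ∧ W.map (tPow (-n)) ≤ W}

/-- The affine (periodic) flag variety: chains `W_0 ⊆ W_1 ⊆ ⋯ ⊆ W_n` in the `n`-reduced Sato
Grassmannian with `virtdim W_i = i - n` and `t ^ (-n) W_n = W_0`. -/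
def AffineFlag (n : ℕ) : Set (Fin (n + 1) → Submodule ℂ Laurent) :=
  {F | Monotone F ∧ (∀ i, F i ∈ ReducedGr n ∧ virtDim (F i) = (i : ℕ) - (n : ℤ)) ∧
    (F (Fin.last n)).map (tPow (-n)) = F 0}

/-! ## Complete curves -/

/-- A complete (possibly singular) integral curve over `ℂ`. -/
structure CompleteCurve where
  /-- the underlying scheme -/
  scheme : Scheme.{0}
  /-- the structure morphism -/
  toSpec : scheme ⟶ Spec (CommRingCat.of ℂ)
  [isIntegral : IsIntegral scheme]
  [isProper : IsProper toSpec]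
  dim_eq_one : topologicalKrullDim scheme = 1

attribute [instance] CompleteCurve.isIntegral CompleteCurve.isProper

variable (X : CompleteCurve)

/-- The points of the curve. -/
abbrev CompleteCurve.Pt : Type := X.scheme

/-- The local ring at a point. -/
abbrev CompleteCurve.O (x : X.Pt) : Type := X.scheme.presheaf.stalk x

/-- The function field. -/
abbrev CompleteCurve.K : Type := X.scheme.functionField

/-- The constants, as global functions. -/
def CompleteCurve.const : ℂ →+* Γ(X.scheme, ⊤) :=
  ((Scheme.ΓSpecIso (CommRingCat.of ℂ)).inv ≫ X.toSpec.appTop).hom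

/-- The constants, in the local ring at `x`. -/
def CompleteCurve.constAt (x : X.Pt) : ℂ →+* X.O x :=
  (X.scheme.presheaf.germ ⊤ x trivial).hom.comp X.const

instance : Algebra ℂ X.K := (X.constAt (genericPoint X.scheme)).toAlgebra

theorem algebraMap_constAt (x : X.Pt) (c : ℂ) :
    algebraMap (X.O x) X.K (X.constAt x c) = algebraMap ℂ X.K c := by
  have h := X.scheme.presheaf.germ_stalkSpecializes (U := ⊤) (y := x) trivial
    ((genericPoint_spec X.scheme).specializes trivial)
  exact congrArg (fun g => g.hom (X.const c)) h

/-- A smooth closed point: the local ring is a discrete valuation ring. -/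
def CompleteCurve.IsSmoothPt (P : X.Pt) : Prop := IsDiscreteValuationRing (X.O P)

/-! ## Formal torsion-free sheaves on `X × Spec ℂ[[s]]`

The deformation parameter is called `s`; in Lean it is the variable of the power series rings
below.  A torsion-free coherent sheaf of rank `n` on `X` is a subsheaf of the constant sheaf `K ^ n`
(after a choice of a basis of its generic fibre) and is given by its stalks in `K ^ n`.  In the same
way a formal deformation of it over `ℂ[[s]]` is given by its (`s`-completed) stalks, which are
modules over `𝒪_{X, x}[[s]]` inside `K[[s]] ^ n`.  -/

/-- A formal torsion-free sheaf of rank `n` over `X × Spec ℂ[[s]]`, embedded into its generic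
fibre. -/
structure FormalSheaf (n : ℕ) where
  /-- the stalks -/
  stalk : ∀ x : X.Pt, Submodule (X.O x)⟦X⟧ (Fin n → (X.K)⟦X⟧)
  /-- the reduction modulo `s` embeds into the reduction of the generic fibre, i.e. the sheaf is a
  deformation of a torsion-free sheaf -/
  saturated : ∀ (x : X.Pt) (v : Fin n → (X.K)⟦X⟧),
    (fun j => PowerSeries.X * v j) ∈ stalk x → v ∈ stalk x
  /-- coherence -/
  locally_finite : ∀ x : X.Pt, ∃ U : X.scheme.Opens, x ∈ U ∧
    ∃ S : Finset (Fin n → (X.K)⟦X⟧), ∀ y ∈ U,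
      stalk y = Submodule.span (X.O y)⟦X⟧ (S : Set (Fin n → (X.K)⟦X⟧))
  /-- the rank is `n` -/
  generic : stalk (genericPoint X.scheme) = ⊤

variable {X}

/-- The stalk at `x` of the torsion-free sheaf on `X` obtained by setting `s = 0`, as a complex
vector space inside `K ^ n`. -/
def FormalSheaf.fibre {n : ℕ} (E : FormalSheaf X n) (x : X.Pt) : Submodule ℂ (Fin n → X.K) where
  carrier := {w | ∃ v ∈ E.stalk x, ∀ j, PowerSeries.constantCoeff (v j) = w j}
  zero_mem' := ⟨0, zero_mem _, fun j => by simp⟩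
  add_mem' := by
    rintro a b ⟨v, hv, hva⟩ ⟨w, hw, hwb⟩
    exact ⟨v + w, add_mem hv hw, fun j => by simp [hva, hwb]⟩
  smul_mem' := by
    rintro c a ⟨v, hv, hva⟩
    refine ⟨PowerSeries.C (X.constAt x c) • v, Submodule.smul_mem _ _ hv, fun j => ?_⟩
    have h : (PowerSeries.C (X.constAt x c) • v) j =
        PowerSeries.C (algebraMap (X.O x) X.K (X.constAt x c)) * v j := by
      rw [Pi.smul_apply, Algebra.smul_def, PowerSeries.algebraMap_apply'', PowerSeries.map_C]
    rw [h, map_mul, PowerSeries.constantCoeff_C, algebraMap_constAt, hva, Pi.smul_apply,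
      Algebra.smul_def]

/-- `E ⊆ F` as subsheaves of the generic fibre. -/
def FormalSheaf.Le {n : ℕ} (E F : FormalSheaf X n) : Prop := ∀ x, E.stalk x ≤ F.stalk x

/-- `F = E(P)`. -/
def FormalSheaf.IsTwist {n : ℕ} (E F : FormalSheaf X n) (P : X.Pt) : Prop :=
  (∀ x, x ≠ P → F.stalk x = E.stalk x) ∧
    ∀ v, v ∈ F.stalk P ↔
      ∀ g ∈ IsLocalRing.maximalIdeal (X.O P), PowerSeries.C g • v ∈ E.stalk P

/-- For `E ⊆ F`, the quotient `F / E` is an invertible sheaf on `P × Spec ℂ[[s]]`: it vanishes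
outside of `P`, and its stalk at `P` is free of rank one over `κ(P)[[s]]`. -/
def FormalSheaf.InvertibleQuot {n : ℕ} (E F : FormalSheaf X n) (P : X.Pt) : Prop :=
  (∀ x, x ≠ P → F.stalk x = E.stalk x) ∧
    Nonempty ((↥(F.stalk P) ⧸ (E.stalk P).submoduleOf (F.stalk P)) ≃ₗ[(X.O P)⟦X⟧]
      (IsLocalRing.ResidueField (X.O P))⟦X⟧)

/-- Sections over `X ∖ P` of the reduction modulo `s`. -/
def FormalSheaf.sectionsAway {n : ℕ} (E : FormalSheaf X n) (P : X.Pt) :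
    Submodule ℂ (Fin n → X.K) :=
  ⨅ x ∈ {x : X.Pt | x ≠ P}, E.fibre x

/-! ### Cohomology of the reduction modulo `s`, by répartitions -/

/-- `H⁰`: the global sections. -/
def FormalSheaf.H0 {n : ℕ} (E : FormalSheaf X n) : Submodule ℂ (Fin n → X.K) := ⨅ x, E.fibre x

/-- The répartitions: families `(r_x)` in `K ^ n` with `r_x ∈ E_x` for almost all `x`. -/
def FormalSheaf.repart {n : ℕ} (E : FormalSheaf X n) : Submodule ℂ (X.Pt → Fin n → X.K) where
  carrier := {r | {x | r x ∉ E.fibre x}.Finite}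
  zero_mem' := by simp
  add_mem' := by
    intro a b ha hb
    refine (ha.union hb).subset fun x hx => ?_
    by_contra h
    simp only [Set.mem_union, Set.mem_ofPred_eq, not_or, not_not] at h
    exact hx (add_mem h.1 h.2)
  smul_mem' := by
    intro c a ha
    refine ha.subset fun x hx h => ?_
    exact hx (Submodule.smul_mem _ c h)

/-- The integral répartitions: `r_x ∈ E_x` for all `x`. -/
def FormalSheaf.integralRepart {n : ℕ} (E : FormalSheaf X n) :
    Submodule ℂ (X.Pt → Fin n → X.K) :=
  Submodule.pi Set.univ E.fibre

/-- The constant families. -/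
def constRepart (X : CompleteCurve) (n : ℕ) : Submodule ℂ (X.Pt → Fin n → X.K) :=
  LinearMap.range (LinearMap.pi fun _ : X.Pt => (LinearMap.id : (Fin n → X.K) →ₗ[ℂ] _))

/-- `H¹`, the cokernel of `K ^ n → ⨁_x K ^ n / E_x`, written as the quotient of the répartitions by
the sum of the integral and the constant ones. -/
abbrev FormalSheaf.H1 {n : ℕ} (E : FormalSheaf X n) : Type :=
  ↥E.repart ⧸ (E.integralRepart ⊔ constRepart X n).submoduleOf E.repart

/-- The Euler characteristic (of the reduction modulo `s`). -/
def FormalSheaf.eulerChar {n : ℕ} (E : FormalSheaf X n) : ℤ :=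
  (Module.finrank ℂ E.H0 : ℤ) - Module.finrank ℂ E.H1

/-! ## Affine opers -/

/-- A local affine `GL_n`-oper on `(X, P)`.  The chain `ℰ_0 ⊆ ℰ_1 ⊆ ⋯ ⊆ ℰ_n = ℰ_0(P)` is extended to
all integers by `ℰ_{i + n} = ℰ_i(P)`. -/
structure LocalAffineOper (X : CompleteCurve) (P : X.Pt) (n : ℕ) where
  /-- the parabolic structure along `P × Spec ℂ[[s]]`; the sheaf itself is `E 0` -/
  E : ℤ → FormalSheaf X n
  le_succ : ∀ i, (E i).Le (E (i + 1))
  isTwist : ∀ i, (E i).IsTwist (E (i + n)) P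
  /-- the (micro)connection, on the generic fibre -/
  nabla : (Fin n → (X.K)⟦X⟧) →+ (Fin n → (X.K)⟦X⟧)
  leibniz : ∀ (g : (X.K)⟦X⟧) (v : Fin n → (X.K)⟦X⟧),
    nabla (fun j => g * v j) =
      fun j => g * nabla v j + PowerSeries.derivative X.K g * v j
  gr_invertible : ∀ i, (E i).InvertibleQuot (E (i + 1)) P
  eulerChar_succ : ∀ i, (E (i + 1)).eulerChar = (E i).eulerChar + 1
  nabla_mem : ∀ (i : ℤ) (x : X.Pt), ∀ v ∈ (E i).stalk x, nabla v ∈ (E (i + 1)).stalk x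
  /-- `ord_P (∇ v) = ord_P v + 1`; equivalently the maps `gr_i → gr_{i + 1}` induced by `∇` are
  injective -/
  nabla_ord : ∀ (i : ℤ), ∀ v ∈ (E (i + 1)).stalk P, v ∉ (E i).stalk P →
    nabla v ∉ (E (i + 1)).stalk P
  /-- the maps `gr_i → gr_{i + 1}` induced by `∇` are surjective -/
  nabla_gr_surjective : ∀ (i : ℤ), ∀ w ∈ (E (i + 2)).stalk P,
    ∃ v ∈ (E (i + 1)).stalk P, w - nabla v ∈ (E (i + 1)).stalk P

/-- A local affine Miura `GL_n`-oper on `(X, P, Q)`: a local affine `GL_n`-oper `(ℰ, ∇)` with another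
parabolic structure `ℰ = ℰ'_0 ⊆ ℰ'_1 ⊆ ⋯ ⊆ ℰ'_n = ℰ(Q)`, along `Q × Spec ℂ[[s]]`, which is preserved
by `∇` (acting on sections with arbitrary poles at `P`). -/
structure LocalAffineMiuraOper (X : CompleteCurve) (P Q : X.Pt) (n : ℕ) extends
    LocalAffineOper X P n where
  /-- the parabolic structure along `Q × Spec ℂ[[s]]` -/
  E' : Fin (n + 1) → FormalSheaf X n
  zero_eq : E' 0 = E 0
  le_succ' : ∀ i : Fin n, (E' i.castSucc).Le (E' i.succ)
  isTwist' : (E' 0).IsTwist (E' (Fin.last n)) Q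
  gr_invertible' : ∀ i : Fin n, (E' i.castSucc).InvertibleQuot (E' i.succ) Q
  nabla_mem' : ∀ (i : Fin (n + 1)) (x : X.Pt), x ≠ P →
    ∀ v ∈ (E' i).stalk x, nabla v ∈ (E' i).stalk x

/-! ## The Krichever map -/

/-- A Krichever trivialization of `(ℰ, ∇)` at `P`: a rational function `f`, which is a local
parameter at `P`, and an isomorphism between the completion at `P` of the generic fibre of
`E = ℰ|_{s = 0}` and `ℂ((t))`, linear over `ℂ((f)) = ℂ((t ^ n))`, which takes the completions of the
stalks of the `E_i` to the lattices `t ^ m ℂ[[t]]`, the one of Euler characteristic `0` to `t ℂ[[t]]`.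
Such an isomorphism is recorded by its restriction `φ` to `K ^ n`: the condition on the stalks makes
`φ` continuous and injective with dense image. -/
structure KricheverTrivialization {X : CompleteCurve} {P : X.Pt} {n : ℕ}
    (M : LocalAffineOper X P n) where
  /-- the rational function whose expansion at `P` is `t ^ n` -/
  f : X.K
  f_uniformizer : ∃ ϖ : X.O P, IsLocalRing.maximalIdeal (X.O P) = Ideal.span {ϖ} ∧
    algebraMap (X.O P) X.K ϖ = f
  φ : (Fin n → X.K) →ₗ[ℂ] Laurent
  map_f_mul : ∀ v, φ (fun j => f * v j) = tPow n (φ v)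
  mem_iff : ∀ (i : ℤ) (v : Fin n → X.K),
    φ v ∈ tLattice (1 - (M.E i).eulerChar) ↔ v ∈ (M.E i).fibre P

/-- The image of `(ℰ, ∇)` under the Krichever map: the space of sections over `X ∖ P` of
`E = ℰ|_{s = 0}`, embedded in `ℂ((t))`. -/
def KricheverTrivialization.image {X : CompleteCurve} {P : X.Pt} {n : ℕ}
    {M : LocalAffineOper X P n} (κ : KricheverTrivialization M) : Submodule ℂ Laurent :=
  ((M.E 0).sectionsAway P).map κ.φ

/-- For submodules `A`, `B`, the image of `A ∩ B` in `B / A₀`. -/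
def imageInQuot {V : Type} [AddCommGroup V] [Module ℂ V] (A₀ A B : Submodule ℂ V) :
    Submodule ℂ (↥B ⧸ A₀.submoduleOf B) :=
  (A.submoduleOf B).map (A₀.submoduleOf B).mkQ

/-- The chain `F_0 ⊆ ⋯ ⊆ F_n` induces in `F_n / F_0` the flag
`ℰ'_1 / ℰ' ⊆ ⋯ ⊆ ℰ'_n / ℰ'` (at `s = 0`), under the identification `θ` of `F_n / F_0` with the
skyscraper `ℰ'_n / ℰ'` at `Q` for which the class of `t ^ (-n) φ(v)`, where `v` is a section of `ℰ'_n`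
over `X ∖ P`, corresponds to the class of `v`. -/
def InducesFlag {X : CompleteCurve} {P Q : X.Pt} {n : ℕ} (M : LocalAffineMiuraOper X P Q n)
    (κ : KricheverTrivialization M.toLocalAffineOper)
    (F : Fin (n + 1) → Submodule ℂ Laurent) : Prop :=
  ∃ θ : (↥(F (Fin.last n)) ⧸ (F 0).submoduleOf (F (Fin.last n))) ≃ₗ[ℂ]
      (↥((M.E' (Fin.last n)).fibre Q) ⧸
        ((M.E' 0).fibre Q).submoduleOf ((M.E' (Fin.last n)).fibre Q)),
    (∀ v ∈ (M.E' (Fin.last n)).sectionsAway P,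
      ∃ (h : tPow (-n) (κ.φ v) ∈ F (Fin.last n)) (h' : v ∈ (M.E' (Fin.last n)).fibre Q),
        θ (Submodule.Quotient.mk ⟨_, h⟩) = Submodule.Quotient.mk ⟨v, h'⟩) ∧
    ∀ i, (imageInQuot (F 0) (F i) (F (Fin.last n))).map (θ : _ →ₗ[ℂ] _) =
      imageInQuot ((M.E' 0).fibre Q) ((M.E' i).fibre Q) ((M.E' (Fin.last n)).fibre Q)

end AffineMiura

end

/-!
Write `y = f⁻¹`, `W = φ(H⁰(X ∖ P, E))`, and let `E_i` denote the sheaves of the oper at `s = 0`.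

*Index.*  The lattices `t ^ m ℂ[[t]]` cut out the stalks of the `E_i` at `P`, all of which agree away
from `P`.  Hence `W ∩ t ^ (1 - χ(E_i)) ℂ[[t]] = H⁰(E_i)`, and, as `φ` has dense image,
`ℂ((t)) / (W + t ^ (1 - χ(E_i)) ℂ[[t]])` is the quotient of `K ^ n` by the sum of `H⁰(X ∖ P, E)` and
the stalk of `E_i` at `P`, that is, the kernel of `H¹(X, E_i) → H¹(X ∖ P, E)`.  If `H¹(X ∖ P, E) = 0`,
it follows that `t ^ m W` is Fredholm of virtual dimension `m` for all `m`
(`KricheverTrivialization.isFredholm_and_virtDim_map_tPow`).  Finiteness of the cohomology is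
a consequence of `χ(E_{i+1}) = χ(E_i) + 1` (`KricheverTrivialization.finite_H0`, `finite_H1`).

*Vanishing of `H¹(X ∖ P, E)`.*  As `W` is `n`-reduced and `φ` is injective, `H⁰(X ∖ P, E)` is stable
under `y`.  If `v` is a nonzero section, then all `y ^ k v` are sections, so the powers of `y` have a
common denominator at each point of `X ∖ P`. Therefore, for the largest `y`-stable subsheaf `E^s`
of `E` on `X ∖ P`, the quotient `E / E^s` has finite-dimensional stalks, almost all of them zero.
So `H¹(X ∖ P, E^s)` is finite-dimensional; all operators `y - c` act surjectively on it, because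
they act surjectively on répartitions, and an operator on a nonzero finite-dimensional complex
vector space has an eigenvalue.
Hence `H¹(X ∖ P, E^s) = 0` (`FormalSheaf.exists_forall_sub_mem_stableFibre`).  Since `E^s` and `E` have
the same sections over `X ∖ P`, this gives `E^s = E`: the whole sheaf is stable under `y` on `X ∖ P`
(`KricheverTrivialization.inv_f_smul_mem_fibre`), and `H¹(X ∖ P, E) = 0`.

*Flag.*  Put `F_i = t ^ (-n) φ(H⁰(X ∖ P, E'_i))`.  Then `F_0 = t ^ (-n) W`, and `F_n ⊆ W` because `y`
preserves `E` and vanishes at `Q`.  By the vanishing of `H¹(X ∖ P, E)`, sections of `E'_i` over `X ∖ P`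
represent every class in `E'_i / E`, so the `F_i` increase strictly.  The virtual dimension is strictly
increasing on Fredholm subspaces (`virtDim_lt`), is `-n` for `F_0` and `0` for `W`; there is only room
for `virtdim F_i = i - n` and `F_n = W`.  The isomorphism `θ` is then induced by
`t ^ (-n) φ(v) ↦ v`, which is prescribed on all of `F_n`, whence the uniqueness.
-/

noncomputable section

namespace AffineMiura

/-! ### Local algebra of complete curves -/

section Curve

variable {X : CompleteCurve}

instance CompleteCurve.isNoetherian : IsNoetherian X.scheme :=
  have := LocallyOfFiniteType.isLocallyNoetherian X.toSpec
  have : CompactSpace X.scheme := QuasiCompact.compactSpace_of_compactSpace X.toSpec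
  {}

/-- On a curve, an irreducible closed subset other than the whole space is a point. -/
theorem subsingleton_of_isIrreducible {Z : Set X.Pt} (hZ : IsClosed Z) (hirr : IsIrreducible Z)
    (hne : Z ≠ Set.univ) : Z.Subsingleton := by
  have hdim : Order.krullDim (TopologicalSpace.IrreducibleCloseds X.Pt) ≤ 1 := X.dim_eq_one.le
  let T : TopologicalSpace.IrreducibleCloseds X.Pt := ⟨Z, hirr, hZ⟩
  let top : TopologicalSpace.IrreducibleCloseds X.Pt :=
    ⟨Set.univ, IrreducibleSpace.isIrreducible_univ _, isClosed_univ⟩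
  have hmin : IsMin T := by
    refine ((Order.krullDim_le_one_iff.mp hdim) T).resolve_right fun hmax => hne ?_
    exact Set.univ_subset_iff.mp (hmax (b := top) (Set.subset_univ Z))
  have key : ∀ z ∈ Z, closure {z} = Z := fun z hz => by
    let C : TopologicalSpace.IrreducibleCloseds X.Pt :=
      ⟨closure {z}, isIrreducible_singleton.closure, isClosed_closure⟩
    have hle : C ≤ T := hZ.closure_subset_iff.mpr (Set.singleton_subset_iff.mpr hz)
    exact subset_antisymm hle (hmin hle)
  intro a ha b hb
  exact IsGenericPoint.eq (S := Z) (key a ha) (key b hb)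

theorem finite_of_isClosed {Z : Set X.Pt} (hZ : IsClosed Z) (hne : Z ≠ Set.univ) : Z.Finite := by
  obtain ⟨S, hS, hcl, hirr, rfl⟩ :=
    TopologicalSpace.NoetherianSpace.exists_finite_set_isClosed_irreducible hZ
  refine hS.sUnion fun t ht => Set.Subsingleton.finite ?_
  refine subsingleton_of_isIrreducible (hcl t ht) (hirr t ht) fun h => hne ?_
  exact Set.univ_subset_iff.mp (h ▸ Set.subset_sUnion_of_mem ht)

theorem isClosed_singleton_of_ne {x : X.Pt} (hx : x ≠ genericPoint X.scheme) :
    IsClosed ({x} : Set X.Pt) := by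
  have h : (closure {x} : Set X.Pt).Subsingleton := by
    refine subsingleton_of_isIrreducible isClosed_closure isIrreducible_singleton.closure
      fun h => hx ?_
    exact IsGenericPoint.eq (S := Set.univ) h (genericPoint_spec X.scheme)
  have h2 : closure {x} = ({x} : Set X.Pt) :=
    h.eq_singleton_of_mem (subset_closure rfl)
  exact h2 ▸ isClosed_closure

/-- A rational function is regular at almost all points. -/
theorem finite_setOf_notMem_range (g : X.K) :
    {x : X.Pt | g ∉ (algebraMap (X.O x) X.K).range}.Finite := by
  obtain ⟨U, hU, s, hs⟩ := X.scheme.presheaf.exists_germ_eq g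
  refine (finite_of_isClosed (Z := (U : Set X.Pt)ᶜ) U.isOpen.isClosed_compl ?_).subset ?_
  · intro h
    exact (h ▸ Set.mem_univ (genericPoint X.scheme) : _ ∈ (U : Set X.Pt)ᶜ) hU
  · intro x hx hxU
    have : Nonempty U := ⟨⟨x, hxU⟩⟩
    exact hx ⟨X.scheme.presheaf.germ U x hxU s,
      (X.scheme.algebraMap_germ_eq_germToFunctionField hxU s).trans hs⟩

theorem krullDimLE_one (x : X.Pt) : Ring.KrullDimLE 1 (X.O x) := by
  rw [Ring.krullDimLE_iff, ← PrimeSpectrum.topologicalKrullDim_eq_ringKrullDim]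
  have h : topologicalKrullDim (Spec (X.scheme.presheaf.stalk x)) ≤ topologicalKrullDim X.scheme :=
    (X.scheme.fromSpecStalk x).isEmbedding.isInducing.topologicalKrullDim_le
  exact h.trans X.dim_eq_one.le

theorem spec_map_constAt (x : X.Pt) :
    Spec.map (CommRingCat.ofHom (X.constAt x)) = X.scheme.fromSpecStalk x ≫ X.toSpec := by
  obtain ⟨ψ, hψ⟩ := Spec.map_surjective (X.scheme.fromSpecStalk x ≫ X.toSpec)
  suffices h : ψ = CommRingCat.ofHom (X.constAt x) by rw [← hψ, h]
  rw [← cancel_mono (Scheme.ΓSpecIso (X.scheme.presheaf.stalk x)).inv,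
    Scheme.ΓSpecIso_inv_naturality, hψ, Scheme.Hom.comp_appTop, Scheme.fromSpecStalk_appTop]
  simp [CompleteCurve.constAt, CompleteCurve.const]

/-- The residue field at a closed point is `ℂ`. -/
theorem exists_sub_constAt_mem_maximalIdeal {x : X.Pt} (hx : IsClosed ({x} : Set X.Pt))
    (r : X.O x) : ∃ c : ℂ, r - X.constAt x c ∈ IsLocalRing.maximalIdeal (X.O x) := by
  let e := residueFieldIsoBase X.toSpec x hx
  have he : e.inv = CommRingCat.ofHom (X.constAt x) ≫ X.scheme.residue x := by
    apply Spec.map_injective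
    rw [SpecMap_residueFieldIsoBase_inv, Spec.map_comp, spec_map_constAt, ← Category.assoc]
    rfl
  refine ⟨e.hom (X.scheme.residue x r), ?_⟩
  rw [← IsLocalRing.residue_eq_zero_iff, map_sub, sub_eq_zero]
  have h2 : e.inv (e.hom (X.scheme.residue x r)) = X.scheme.residue x r := by simp
  rw [he] at h2
  exact h2.symm

end Curve

/-! ### Finite-dimensional quotients of modules over one-dimensional local domains -/

section LocalRing

variable {A M : Type*} [CommRing A] [Algebra ℂ A] [IsLocalRing A] [AddCommGroup M] [Module A M]
  [Module ℂ M] [IsScalarTower ℂ A M]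

/-- If `A` has residue field `ℂ` and `N` is finitely generated, then `N / 𝔪 N` is finite-dimensional
over `ℂ`. -/
theorem exists_fg_forall_sub_mem_smul
    (hres : ∀ r : A, ∃ c : ℂ, r - algebraMap ℂ A c ∈ IsLocalRing.maximalIdeal A)
    {N : Submodule A M} (hN : N.FG) :
    ∃ U : Submodule ℂ M, U.FG ∧ (∀ u ∈ U, u ∈ N) ∧
      ∀ e ∈ N, ∃ u ∈ U, e - u ∈ IsLocalRing.maximalIdeal A • N := by
  obtain ⟨S, rfl⟩ := hN
  refine ⟨Submodule.span ℂ S, ⟨S, rfl⟩, fun u hu => Submodule.span_le_restrictScalars ℂ A _ hu,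
    fun e he => ?_⟩
  induction he using Submodule.span_induction with
  | mem s hs => exact ⟨s, Submodule.subset_span hs, by simp⟩
  | zero => exact ⟨0, zero_mem _, by simp⟩
  | add a b _ _ iha ihb =>
    obtain ⟨u, hu, hu'⟩ := iha
    obtain ⟨v, hv, hv'⟩ := ihb
    exact ⟨u + v, add_mem hu hv, by simpa [add_sub_add_comm] using add_mem hu' hv'⟩
  | smul r e he ih =>
    obtain ⟨u, hu, hu'⟩ := ih
    obtain ⟨c, hc⟩ := hres r
    refine ⟨c • u, Submodule.smul_mem _ _ hu, ?_⟩
    have : r • e - c • u = (r - algebraMap ℂ A c) • e + c • (e - u) := by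
      rw [sub_smul, algebraMap_smul, smul_sub]; abel
    rw [this]
    refine add_mem (Submodule.smul_mem_smul hc he) ?_
    rw [← algebraMap_smul A c]
    exact Submodule.smul_mem _ _ hu'

theorem exists_fg_forall_sub_mem_pow_smul [IsNoetherianRing A]
    (hres : ∀ r : A, ∃ c : ℂ, r - algebraMap ℂ A c ∈ IsLocalRing.maximalIdeal A)
    {N : Submodule A M} (hN : N.FG) (k : ℕ) :
    ∃ U : Submodule ℂ M, U.FG ∧ (∀ u ∈ U, u ∈ N) ∧
      ∀ e ∈ N, ∃ u ∈ U, e - u ∈ IsLocalRing.maximalIdeal A ^ k • N := by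
  induction k with
  | zero => exact ⟨⊥, Submodule.fg_bot, by simp, fun e he => ⟨0, zero_mem _, by simpa using he⟩⟩
  | succ k ih =>
    obtain ⟨U, hU, hUN, h⟩ := ih
    have hfg : (IsLocalRing.maximalIdeal A ^ k • N).FG :=
      Submodule.FG.smul ((isNoetherianRing_iff_ideal_fg A).mp inferInstance _) hN
    obtain ⟨U', hU', hUN', h'⟩ := exists_fg_forall_sub_mem_smul hres hfg
    refine ⟨U ⊔ U', hU.sup hU', ?_, fun e he => ?_⟩
    · intro u hu
      obtain ⟨a, ha, b, hb, rfl⟩ := Submodule.mem_sup.mp hu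
      exact add_mem (hUN a ha) (Submodule.smul_le_right (hUN' b hb))
    · obtain ⟨u, hu, hu2⟩ := h e he
      obtain ⟨u', hu', hu2'⟩ := h' _ hu2
      refine ⟨u + u', Submodule.add_mem_sup hu hu', ?_⟩
      rw [pow_succ', mul_smul, ← sub_sub]
      exact hu2'

/-- If `A` is moreover a Noetherian domain of dimension at most one, then `N / a N` is finite-dimensional for
every nonzero `a`. -/
theorem exists_fg_forall_eq_add_smul [IsNoetherianRing A] [IsDomain A] [Ring.KrullDimLE 1 A]
    (hres : ∀ r : A, ∃ c : ℂ, r - algebraMap ℂ A c ∈ IsLocalRing.maximalIdeal A)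
    {N : Submodule A M} (hN : N.FG) {a : A} (ha : a ≠ 0) :
    ∃ U : Submodule ℂ M, U.FG ∧ (∀ u ∈ U, u ∈ N) ∧
      ∀ e ∈ N, ∃ u ∈ U, ∃ e' ∈ N, e = u + a • e' := by
  -- The maximal ideal is the only prime ideal containing `a`, unless `a` is a unit.
  obtain ⟨k, hk⟩ : ∃ k, IsLocalRing.maximalIdeal A ^ k ≤ Ideal.span {a} := by
    by_cases hu : IsUnit a
    · exact ⟨0, by simp [Ideal.span_singleton_eq_top.mpr hu]⟩
    · apply Ideal.exists_pow_le_of_le_radical_of_fg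
      · rw [Ideal.radical_eq_sInf]
        refine le_sInf fun J hJ => ?_
        have := hJ.2
        have hJ0 : J ≠ ⊥ := by
          rintro rfl
          exact ha (by simpa using hJ.1)
        have : J.IsMaximal := Ring.krullDimLE_one_iff_of_noZeroDivisors.mp ‹_› J hJ0 hJ.2
        exact (IsLocalRing.eq_maximalIdeal this).ge
      · exact (isNoetherianRing_iff_ideal_fg A).mp inferInstance _
  obtain ⟨U, hU, hUN, h⟩ := exists_fg_forall_sub_mem_pow_smul hres hN k
  refine ⟨U, hU, hUN, fun e he => ?_⟩
  obtain ⟨u, hu, hu2⟩ := h e he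
  have h3 := Submodule.smul_mono_left hk hu2
  rw [Submodule.ideal_span_singleton_smul] at h3
  obtain ⟨e', he', h4⟩ := h3
  exact ⟨u, hu, e', he', by rw [← sub_eq_iff_eq_add', ← h4]; rfl⟩

end LocalRing

/-! ### The stalks of the reduction modulo `s` -/

section Fibre

variable {X : CompleteCurve} {n : ℕ}

instance {R : Type*} [CommRing R] : RingHomSurjective (PowerSeries.constantCoeff (R := R)) :=
  ⟨PowerSeries.constantCoeff_surj⟩

/-- Reduction modulo `s` of the generic fibre, as a map semilinear over the reduction of the local
ring at `x`. -/
def reduction (x : X.Pt) : (Fin n → (X.K)⟦X⟧) →ₛₗ[PowerSeries.constantCoeff (R := X.O x)]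
    (Fin n → X.K) where
  toFun v j := PowerSeries.constantCoeff (v j)
  map_add' v w := by ext j; simp
  map_smul' g v := by
    ext j
    have h : PowerSeries.constantCoeff (PowerSeries.map (algebraMap (X.O x) X.K) g) =
        algebraMap (X.O x) X.K (PowerSeries.constantCoeff g) := by
      simpa only [PowerSeries.coeff_zero_eq_constantCoeff] using
        PowerSeries.coeff_map (algebraMap (X.O x) X.K) 0 g
    rw [Pi.smul_apply, Pi.smul_apply, Algebra.smul_def, Algebra.smul_def,
      PowerSeries.algebraMap_apply'', map_mul, h]

/-- `FormalSheaf.fibre` with its structure of a module over the local ring. -/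
def FormalSheaf.stalkMod (E : FormalSheaf X n) (x : X.Pt) : Submodule (X.O x) (Fin n → X.K) :=
  (E.stalk x).map (reduction x)

theorem FormalSheaf.mem_stalkMod {E : FormalSheaf X n} {x : X.Pt} {v : Fin n → X.K} :
    v ∈ E.stalkMod x ↔ v ∈ E.fibre x := by
  constructor
  · rintro ⟨w, hw, rfl⟩
    exact ⟨w, hw, fun j => rfl⟩
  · rintro ⟨w, hw, h⟩
    exact ⟨w, hw, funext h⟩

theorem FormalSheaf.stalkMod_fg (E : FormalSheaf X n) (x : X.Pt) : (E.stalkMod x).FG := by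
  classical
  obtain ⟨U, hxU, S, hS⟩ := E.locally_finite x
  refine ⟨S.image (reduction x), ?_⟩
  rw [FormalSheaf.stalkMod, hS x hxU, Submodule.map_span, Finset.coe_image]

theorem FormalSheaf.mul_mem_fibre (E : FormalSheaf X n) {x : X.Pt} {g : X.K}
    (hg : g ∈ (algebraMap (X.O x) X.K).range) {v : Fin n → X.K} (hv : v ∈ E.fibre x) :
    g • v ∈ E.fibre x := by
  obtain ⟨a, rfl⟩ := hg
  rw [algebraMap_smul]
  exact mem_stalkMod.mp (Submodule.smul_mem _ a (mem_stalkMod.mpr hv))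

/-- A torsion-free coherent sheaf has bounded denominators. -/
theorem FormalSheaf.exists_denominator (E : FormalSheaf X n) (x : X.Pt) :
    ∃ d : X.O x, d ≠ 0 ∧ ∀ v ∈ E.fibre x, ∀ j,
      algebraMap (X.O x) X.K d * v j ∈ (algebraMap (X.O x) X.K).range := by
  classical
  obtain ⟨S, hS⟩ := E.stalkMod_fg x
  obtain ⟨d, hd⟩ := IsLocalization.exist_integer_multiples_of_finset (nonZeroDivisors (X.O x))
    (S.biUnion fun v => Finset.univ.image v)
  refine ⟨d, nonZeroDivisors.coe_ne_zero d, fun v hv j => ?_⟩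
  rw [← FormalSheaf.mem_stalkMod, ← hS] at hv
  induction hv using Submodule.span_induction with
  | mem s hs =>
    have := hd (s j) (Finset.mem_biUnion.mpr ⟨s, hs, Finset.mem_image_of_mem _ (Finset.mem_univ j)⟩)
    rw [Algebra.smul_def] at this
    exact this
  | zero => simp
  | add a b _ _ iha ihb => rw [Pi.add_apply, mul_add]; exact add_mem iha ihb
  | smul r e he ih =>
    rw [Pi.smul_apply, Algebra.smul_def, mul_left_comm]
    exact mul_mem ⟨r, rfl⟩ ih

/-- `E_x / a E_x` is finite-dimensional for every nonzero `a`. -/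
theorem FormalSheaf.exists_fg_fibre (E : FormalSheaf X n) {x : X.Pt}
    (hx : x ≠ genericPoint X.scheme) {a : X.O x} (ha : a ≠ 0) :
    ∃ U : Submodule ℂ (Fin n → X.K), U.FG ∧ U ≤ E.fibre x ∧
      ∀ e ∈ E.fibre x, ∃ u ∈ U, ∃ e' ∈ E.fibre x, e = u + algebraMap (X.O x) X.K a • e' := by
  let : Algebra ℂ (X.O x) := (X.constAt x).toAlgebra
  have : IsScalarTower ℂ (X.O x) X.K :=
    IsScalarTower.of_algebraMap_eq fun c => (algebraMap_constAt _ x c).symm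
  have := krullDimLE_one x
  obtain ⟨U, hU, hUN, h⟩ := exists_fg_forall_eq_add_smul (A := X.O x)
    (exists_sub_constAt_mem_maximalIdeal (isClosed_singleton_of_ne hx)) (E.stalkMod_fg x) ha
  refine ⟨U, hU, fun u hu => mem_stalkMod.mp (hUN u hu), fun e he => ?_⟩
  obtain ⟨u, hu, e', he', rfl⟩ := h e (mem_stalkMod.mpr he)
  exact ⟨u, hu, e', mem_stalkMod.mp he', by rw [algebraMap_smul]⟩

end Fibre

/-! ### Linear algebra -/

section LinearAlgebra

variable {V : Type*} [AddCommGroup V] [Module ℂ V]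

theorem exists_fg_of_finite_quotient {R B : Submodule ℂ V}
    (h : Module.Finite ℂ (↥R ⧸ B.submoduleOf R)) :
    ∃ U : Submodule ℂ V, U.FG ∧ U ≤ R ∧ R ≤ U ⊔ B := by
  obtain ⟨s, hs⟩ := (B.submoduleOf R).mkQ.exists_rightInverse_of_surjective
    (LinearMap.range_eq_top.mpr (Submodule.mkQ_surjective _))
  refine ⟨(LinearMap.range s).map R.subtype,
    Submodule.FG.map _ (Module.Finite.iff_fg.mp inferInstance),
    Submodule.map_subtype_le _ _, fun r hr => ?_⟩
  let q := (B.submoduleOf R).mkQ ⟨r, hr⟩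
  have h1 : (⟨r, hr⟩ : R) - s q ∈ B.submoduleOf R := by
    rw [← Submodule.Quotient.mk_eq_zero, Submodule.Quotient.mk_sub, sub_eq_zero]
    exact (LinearMap.congr_fun hs q).symm
  rw [← add_sub_cancel (s q : V) r]
  exact Submodule.add_mem_sup (Submodule.mem_map_of_mem ⟨q, rfl⟩) h1

theorem finite_quotient_of_fg {R B U : Submodule ℂ V} (hU : U.FG) (h : R ≤ U ⊔ B) :
    Module.Finite ℂ (↥R ⧸ B.submoduleOf R) := by
  have : Module.Finite ℂ ↥(U.map B.mkQ) := Module.Finite.iff_fg.mpr (hU.map _)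
  have hmem : ∀ r : R, B.mkQ r ∈ U.map B.mkQ := fun r => by
    obtain ⟨u, hu, b, hb, hub⟩ := Submodule.mem_sup.mp (h r.2)
    refine ⟨u, hu, ?_⟩
    have hb0 : B.mkQ b = 0 := (Submodule.Quotient.mk_eq_zero B).mpr hb
    rw [← hub, map_add, hb0, add_zero]
  let f : R →ₗ[ℂ] ↥(U.map B.mkQ) := (B.mkQ ∘ₗ R.subtype).codRestrict _ hmem
  have hk : LinearMap.ker f = B.submoduleOf R := by
    ext r
    rw [LinearMap.mem_ker, ← Subtype.coe_inj]
    exact Submodule.Quotient.mk_eq_zero B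
  refine Module.Finite.of_injective ((B.submoduleOf R).liftQ f hk.ge) ?_
  rw [← LinearMap.ker_eq_bot]
  exact Submodule.ker_liftQ_eq_bot' _ _ hk.symm

/-- Let `R / B` be finite-dimensional.  If `T - c` is surjective on `R`, and hence on `R / B`, for every
scalar `c`, then `R / B = 0`, as `T` has no eigenvalue on it. -/
theorem le_of_forall_sub_smul_surjective {R B U : Submodule ℂ V} (T : V →ₗ[ℂ] V)
    (hTR : ∀ r ∈ R, T r ∈ R) (hTB : ∀ b ∈ B, T b ∈ B)
    (hsurj : ∀ c : ℂ, ∀ r ∈ R, ∃ r' ∈ R, T r' - c • r' = r)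
    (hU : U.FG) (h : R ≤ U ⊔ B) : R ≤ B := by
  have hfin := finite_quotient_of_fg hU h
  let T₁ : R →ₗ[ℂ] R := T.restrict hTR
  let T₂ : (↥R ⧸ B.submoduleOf R) →ₗ[ℂ] (↥R ⧸ B.submoduleOf R) :=
    (B.submoduleOf R).mapQ (B.submoduleOf R) T₁ fun r hr => hTB _ hr
  have hsub : Subsingleton (↥R ⧸ B.submoduleOf R) := by
    by_contra hne
    rw [not_subsingleton_iff_nontrivial] at hne
    obtain ⟨c, hc⟩ := Module.End.exists_eigenvalue T₂
    obtain ⟨q, hq, hq0⟩ := hc.exists_hasEigenvector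
    have hs : Function.Surjective (T₂ - c • (1 : Module.End ℂ (↥R ⧸ B.submoduleOf R))) := by
      intro q
      obtain ⟨r, rfl⟩ := Submodule.mkQ_surjective _ q
      obtain ⟨r', hr', h⟩ := hsurj c r r.2
      refine ⟨(B.submoduleOf R).mkQ ⟨r', hr'⟩, ?_⟩
      have : T₁ ⟨r', hr'⟩ - c • ⟨r', hr'⟩ = r := Subtype.ext h
      rw [← this]
      rfl
    have hi := LinearMap.injective_iff_surjective.mpr hs
    refine hq0 (hi ?_)
    rw [map_zero, LinearMap.sub_apply, Module.End.mem_eigenspace_iff.mp hq]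
    simp
  intro r hr
  have := Subsingleton.elim ((B.submoduleOf R).mkQ ⟨r, hr⟩) 0
  exact (Submodule.Quotient.mk_eq_zero (B.submoduleOf R)).mp this

end LinearAlgebra

/-! ### Laurent series and virtual dimensions -/

section Laurent

/-- The coefficient of `t ^ k`, as a linear form. -/
def coeffHom (k : ℤ) : Laurent →ₗ[ℂ] ℂ where
  toFun g := g.coeff k
  map_add' a b := HahnSeries.coeff_add (Γ := ℤ) (R := ℂ) (x := a) (y := b) (a := k)
  map_smul' c g := Laurent.coeff_smul c g k

theorem mem_tLattice {m : ℤ} {g : Laurent} : g ∈ tLattice m ↔ ∀ k < m, coeffHom k g = 0 := Iff.rfl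

theorem coeffHom_tPow (m k : ℤ) (g : Laurent) : coeffHom k (tPow m g) = coeffHom (k - m) g := by
  have h := HahnSeries.coeff_single_mul_add (Γ := ℤ) (R := ℂ) (r := 1) (x := g) (a := k - m) (b := m)
  rw [sub_add_cancel, one_mul] at h
  exact h

theorem ext_coeffHom {g h : Laurent} (H : ∀ k, coeffHom k g = coeffHom k h) : g = h :=
  HahnSeries.ext (funext H)

theorem tPow_tPow (a b : ℤ) (g : Laurent) : tPow a (tPow b g) = tPow (a + b) g :=
  ext_coeffHom fun k => by simp only [coeffHom_tPow, sub_sub]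

theorem tPow_zero (g : Laurent) : tPow 0 g = g :=
  ext_coeffHom fun k => by simp only [coeffHom_tPow, sub_zero]

/-- Multiplication by `t ^ m` as an automorphism. -/
def tPowEquiv (m : ℤ) : Laurent ≃ₗ[ℂ] Laurent :=
  LinearEquiv.ofLinearMap (tPow m) (tPow (-m))
    (LinearMap.ext fun g => by simp [tPow_tPow, tPow_zero])
    (LinearMap.ext fun g => by simp [tPow_tPow, tPow_zero])

theorem tPow_mem_tLattice {m k : ℤ} {g : Laurent} :
    tPow m g ∈ tLattice k ↔ g ∈ tLattice (k - m) := by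
  simp only [mem_tLattice, coeffHom_tPow]
  exact ⟨fun h j hj => by simpa using h (j + m) (by lia), fun h j hj => h _ (by lia)⟩

theorem map_tPow_tLattice (m k : ℤ) : (tLattice k).map (tPow m) = tLattice (k + m) := by
  ext g
  constructor
  · rintro ⟨h, hh, rfl⟩
    exact tPow_mem_tLattice.mpr (by simpa using hh)
  · intro hg
    refine ⟨tPow (-m) g, tPow_mem_tLattice.mpr (by simpa using hg), ?_⟩
    rw [tPow_tPow, add_neg_cancel, tPow_zero]

theorem exists_mem_tLattice (g : Laurent) : ∃ k, g ∈ tLattice k :=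
  ⟨HahnSeries.order (Γ := ℤ) (R := ℂ) g,
    fun _ hj => HahnSeries.coeff_eq_zero_of_lt_order (Γ := ℤ) (R := ℂ) hj⟩

theorem tLattice_antitone : Antitone tLattice := fun _ _ h _ hg k hk => hg k (hk.trans_le h)

theorem mem_tLattice_succ {m : ℤ} {g : Laurent} :
    g ∈ tLattice (m + 1) ↔ g ∈ tLattice m ∧ coeffHom m g = 0 := by
  simp only [mem_tLattice]
  refine ⟨fun h => ⟨fun k hk => h k (by lia), h m (by lia)⟩, fun h k hk => ?_⟩
  rcases (Int.lt_add_one_iff.mp hk).lt_or_eq with h1 | rfl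
  exacts [h.1 k h1, h.2]

theorem ker_gammaMap (W : Submodule ℂ Laurent) :
    LinearMap.ker (gammaMap W) = (tLattice 1).comap W.subtype := by
  rw [gammaMap, LinearMap.ker_comp, Submodule.ker_mkQ]

/-- The kernel of `γ_W` is `W ∩ t ℂ[[t]]`. -/
def kerGammaEquiv (W : Submodule ℂ Laurent) :
    LinearMap.ker (gammaMap W) ≃ₗ[ℂ] ↥(W ⊓ tLattice 1) :=
  (LinearMap.ker (gammaMap W)).equivMapOfInjective W.subtype W.injective_subtype ≪≫ₗ
    LinearEquiv.ofEq _ _ (by rw [ker_gammaMap, Submodule.map_comap_subtype])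

/-- The cokernel of `γ_W` is `ℂ((t)) / (t ℂ[[t]] + W)`. -/
def cokerGammaEquiv (W : Submodule ℂ Laurent) :
    ((Laurent ⧸ tLattice 1) ⧸ LinearMap.range (gammaMap W)) ≃ₗ[ℂ] Laurent ⧸ (tLattice 1 ⊔ W) :=
  Submodule.quotEquivOfEq _ _ (by rw [gammaMap, LinearMap.range_comp, Submodule.range_subtype]) ≪≫ₗ
    Submodule.quotientQuotientEquivQuotientSup (tLattice 1) W

theorem isFredholm_iff {W : Submodule ℂ Laurent} :
    IsFredholm W ↔ FiniteDimensional ℂ ↥(W ⊓ tLattice 1) ∧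
      FiniteDimensional ℂ (Laurent ⧸ (tLattice 1 ⊔ W)) :=
  and_congr (Module.Finite.equiv_iff (kerGammaEquiv W))
    (Module.Finite.equiv_iff (cokerGammaEquiv W))

theorem virtDim_eq (W : Submodule ℂ Laurent) :
    virtDim W = (Module.finrank ℂ ↥(W ⊓ tLattice 1) : ℤ) -
      Module.finrank ℂ (Laurent ⧸ (tLattice 1 ⊔ W)) := by
  rw [virtDim, (kerGammaEquiv W).finrank_eq, (cokerGammaEquiv W).finrank_eq]

theorem IsFredholm.of_le_of_le {A B C : Submodule ℂ Laurent} (hA : IsFredholm A)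
    (hC : IsFredholm C) (hAB : A ≤ B) (hBC : B ≤ C) : IsFredholm B := by
  rw [isFredholm_iff] at *
  have := hC.1
  have := hA.2
  exact ⟨Submodule.finiteDimensional_of_le (inf_le_inf_right _ hBC),
    Module.Finite.of_surjective _ (Submodule.factor_surjective (sup_le_sup_left hAB _))⟩

/-- The virtual dimension is strictly increasing on Fredholm subspaces: if `A ⊆ B` have the same
virtual dimension, then they have the same intersection and the same sum with `t ℂ[[t]]`, and are
equal by the modular law. -/
theorem virtDim_lt {A B : Submodule ℂ Laurent} (hA : IsFredholm A) (hB : IsFredholm B)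
    (h : A < B) : virtDim A < virtDim B := by
  rw [isFredholm_iff] at hA hB
  have := hA.2
  have := hB.1
  have := hB.2
  have h1 : A ⊓ tLattice 1 ≤ B ⊓ tLattice 1 := inf_le_inf_right _ h.le
  have h2 : tLattice 1 ⊔ A ≤ tLattice 1 ⊔ B := sup_le_sup_left h.le _
  have hs := Submodule.factor_surjective h2
  have d1 := Submodule.finrank_mono h1
  have d2 := LinearMap.finrank_le_finrank_of_surjective hs
  rw [virtDim_eq, virtDim_eq]
  by_contra hlt
  have e1 := Submodule.eq_of_le_of_finrank_eq h1 (by lia)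
  have e2 : tLattice 1 ⊔ B ≤ tLattice 1 ⊔ A := by
    have hi := (LinearMap.injective_iff_surjective_of_finrank_eq_finrank
      (f := Submodule.factor h2) (by lia)).mpr hs
    intro b hb
    rw [← Submodule.Quotient.mk_eq_zero]
    apply hi
    rw [map_zero]
    exact (Submodule.Quotient.mk_eq_zero _).mpr hb
  refine h.ne (eq_of_le_of_inf_le_of_sup_le (z := tLattice 1) h.le e1.ge ?_)
  rwa [sup_comm, sup_comm A]

theorem virtDim_mono {A B : Submodule ℂ Laurent} (hA : IsFredholm A) (hB : IsFredholm B)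
    (h : A ≤ B) : virtDim A ≤ virtDim B := by
  rcases h.eq_or_lt with rfl | h
  exacts [le_rfl, (virtDim_lt hA hB h).le]

/-- Multiplication by `t ^ m` identifies `W ∩ t ^ (1 - m) ℂ[[t]]` with `t ^ m W ∩ t ℂ[[t]]`. -/
def kerShiftEquiv (W : Submodule ℂ Laurent) (m : ℤ) :
    ↥(W ⊓ tLattice (1 - m)) ≃ₗ[ℂ] ↥(W.map (tPow m) ⊓ tLattice 1) :=
  (W ⊓ tLattice (1 - m)).equivMapOfInjective (tPow m) (tPowEquiv m).injective ≪≫ₗ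
    LinearEquiv.ofEq _ _ (by
      rw [Submodule.map_inf (tPow m) (tPowEquiv m).injective, map_tPow_tLattice, sub_add_cancel])

/-- Multiplication by `t ^ m` identifies `ℂ((t)) / (t ^ (1 - m) ℂ[[t]] + W)` with
`ℂ((t)) / (t ℂ[[t]] + t ^ m W)`. -/
def cokerShiftEquiv (W : Submodule ℂ Laurent) (m : ℤ) :
    (Laurent ⧸ (tLattice (1 - m) ⊔ W)) ≃ₗ[ℂ] Laurent ⧸ (tLattice 1 ⊔ W.map (tPow m)) :=
  Submodule.Quotient.equiv _ _ (tPowEquiv m) (by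
    change (tLattice (1 - m) ⊔ W).map (tPow m) = _
    rw [Submodule.map_sup, map_tPow_tLattice, sub_add_cancel])

end Laurent

/-! ### Comparison of formal sheaves -/

section Compare

variable {X : CompleteCurve} {n : ℕ}

theorem FormalSheaf.fibre_mono {E F : FormalSheaf X n} {x : X.Pt} (h : E.stalk x ≤ F.stalk x) :
    E.fibre x ≤ F.fibre x := fun _ ⟨v, hv, hw⟩ => ⟨v, h hv, hw⟩

theorem FormalSheaf.fibre_congr {E F : FormalSheaf X n} {x : X.Pt} (h : E.stalk x = F.stalk x) :
    E.fibre x = F.fibre x := (fibre_mono h.le).antisymm (fibre_mono h.ge)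

theorem FormalSheaf.mem_sectionsAway {E : FormalSheaf X n} {P : X.Pt} {v : Fin n → X.K} :
    v ∈ E.sectionsAway P ↔ ∀ x ≠ P, v ∈ E.fibre x := by
  simp [sectionsAway, Submodule.mem_iInf]

theorem FormalSheaf.mem_H0 {E : FormalSheaf X n} {v : Fin n → X.K} :
    v ∈ E.H0 ↔ ∀ x, v ∈ E.fibre x := by
  simp [H0, Submodule.mem_iInf]

theorem FormalSheaf.mem_repart {E : FormalSheaf X n} {r : X.Pt → Fin n → X.K} :
    r ∈ E.repart ↔ {x | r x ∉ E.fibre x}.Finite := Iff.rfl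

theorem FormalSheaf.mem_integralRepart {E : FormalSheaf X n} {r : X.Pt → Fin n → X.K} :
    r ∈ E.integralRepart ↔ ∀ x, r x ∈ E.fibre x := by
  simp [integralRepart, Submodule.mem_pi]

theorem mem_constRepart {r : X.Pt → Fin n → X.K} :
    r ∈ constRepart X n ↔ ∃ w, ∀ x, r x = w :=
  ⟨fun ⟨w, hw⟩ => ⟨w, fun x => by rw [← hw]; rfl⟩, fun ⟨w, hw⟩ => ⟨w, funext fun x => (hw x).symm⟩⟩

theorem FormalSheaf.repart_congr {E F : FormalSheaf X n} {P : X.Pt}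
    (h : ∀ x ≠ P, E.fibre x = F.fibre x) : E.repart = F.repart := by
  have key : ∀ {E F : FormalSheaf X n}, (∀ x ≠ P, E.fibre x = F.fibre x) → E.repart ≤ F.repart := by
    intro E F h r hr
    refine ((mem_repart.mp hr).union (Set.finite_singleton P)).subset fun x hx => ?_
    by_cases hxP : x = P
    · exact Or.inr hxP
    · exact Or.inl (by rw [Set.mem_ofPred_eq, h x hxP]; exact hx)
  exact (key h).antisymm (key fun x hx => (h x hx).symm)

/-- If `F / E` is invertible on `P × Spec ℂ[[s]]`, then `E` and `F` differ at `s = 0`: a generator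
of `F / E` which lay in `E` for `s = 0` would be divisible by `s`. -/
theorem FormalSheaf.InvertibleQuot.fibre_lt {E F : FormalSheaf X n} {P : X.Pt}
    (h : E.InvertibleQuot F P) (hle : E.Le F) : E.fibre P < F.fibre P := by
  refine lt_of_le_not_ge (fibre_mono (hle P)) fun hge => ?_
  obtain ⟨e⟩ := h.2
  obtain ⟨⟨v, hv⟩, hve⟩ := Submodule.mkQ_surjective _ (e.symm 1)
  obtain ⟨w, hw, hwv⟩ := hge ⟨v, hv, fun j => rfl⟩
  have hX : ∀ j, ∃ u, v j - w j = PowerSeries.X * u := fun j =>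
    PowerSeries.X_dvd_iff.mpr (by rw [map_sub, hwv, sub_self])
  choose u hu using hX
  have huF : u ∈ F.stalk P := by
    refine F.saturated P u ?_
    rw [← funext hu]
    exact sub_mem hv (hle P hw)
  have hsmul : (PowerSeries.X : (X.O P)⟦X⟧) • u = v - w := by
    ext1 j
    rw [Pi.smul_apply, Algebra.smul_def, PowerSeries.algebraMap_apply'', PowerSeries.map_X]
    exact (hu j).symm
  let Eq := (E.stalk P).submoduleOf (F.stalk P)
  have h1 : Eq.mkQ ⟨v, hv⟩ = (PowerSeries.X : (X.O P)⟦X⟧) • Eq.mkQ ⟨u, huF⟩ := by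
    rw [← map_smul, ← sub_eq_zero, ← map_sub]
    refine (Submodule.Quotient.mk_eq_zero _).mpr ?_
    change v - (PowerSeries.X : (X.O P)⟦X⟧) • u ∈ E.stalk P
    rw [hsmul, sub_sub_cancel]
    exact hw
  have h2 : (1 : (IsLocalRing.ResidueField (X.O P))⟦X⟧) =
      (PowerSeries.X : (X.O P)⟦X⟧) • e (Eq.mkQ ⟨u, huF⟩) := by
    rw [← map_smul, ← h1, hve, LinearEquiv.apply_symm_apply]
  rw [Algebra.smul_def, PowerSeries.algebraMap_apply'', PowerSeries.map_X] at h2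
  have h3 := congrArg PowerSeries.constantCoeff h2
  simp at h3

theorem finrank_eq_zero_of_not_finite {V : Type*} [AddCommGroup V] [Module ℂ V]
    (h : ¬ Module.Finite ℂ V) : Module.finrank ℂ V = 0 :=
  Module.finrank_of_not_finite h

theorem exists_le_span_sup_ker {V : Type*} [AddCommGroup V] [Module ℂ V] (S : Submodule ℂ V)
    (l : V →ₗ[ℂ] ℂ) : ∃ u ∈ S, S ≤ Submodule.span ℂ {u} ⊔ (S ⊓ LinearMap.ker l) := by
  by_cases h : ∀ v ∈ S, l v = 0
  · exact ⟨0, zero_mem _, fun v hv => Submodule.mem_sup_right ⟨hv, h v hv⟩⟩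
  · push Not at h
    obtain ⟨u, hu, hlu⟩ := h
    refine ⟨u, hu, fun v hv => ?_⟩
    rw [← add_sub_cancel ((l v / l u) • u) v]
    refine Submodule.add_mem_sup (Submodule.smul_mem _ _ (Submodule.mem_span_singleton_self u))
      ⟨sub_mem hv (Submodule.smul_mem _ _ hu), ?_⟩
    rw [SetLike.mem_coe, LinearMap.mem_ker, map_sub, map_smul, smul_eq_mul, div_mul_cancel₀ _ hlu, sub_self]

end Compare

/-! ### The cohomology of an oper -/

section Oper

variable {X : CompleteCurve} {P : X.Pt} {n : ℕ} (M : LocalAffineOper X P n)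

theorem LocalAffineOper.fibre_eq (i : ℤ) {x : X.Pt} (hx : x ≠ P) :
    (M.E i).fibre x = (M.E 0).fibre x := by
  induction i with
  | zero => rfl
  | succ i ih => rw [← ih, FormalSheaf.fibre_congr ((M.gr_invertible i).1 x hx)]
  | pred i ih =>
    rw [← ih, ← FormalSheaf.fibre_congr ((M.gr_invertible (-i - 1)).1 x hx), sub_add_cancel]

theorem LocalAffineOper.eulerChar_eq (i : ℤ) : (M.E i).eulerChar = (M.E 0).eulerChar + i := by
  induction i with
  | zero => simp
  | succ i ih => rw [M.eulerChar_succ, ih, add_assoc]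
  | pred i ih =>
    have := M.eulerChar_succ (-i - 1)
    rw [sub_add_cancel, ih] at this
    lia

variable {M} (κ : KricheverTrivialization M)
include κ

/-- Inside `E_{i+1}`, the stalk of `E_i` at `P` is cut out by the leading coefficient of `φ`. -/
theorem KricheverTrivialization.fibre_eq_inf_ker (i : ℤ) : (M.E i).fibre P =
    (M.E (i + 1)).fibre P ⊓ LinearMap.ker (coeffHom (-(M.E i).eulerChar) ∘ₗ κ.φ) := by
  ext v
  have h : 1 - (M.E i).eulerChar = (1 - (M.E (i + 1)).eulerChar) + 1 := by
    rw [M.eulerChar_succ]; ring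
  have h' : 1 - (M.E (i + 1)).eulerChar = -(M.E i).eulerChar := by rw [M.eulerChar_succ]; ring
  rw [Submodule.mem_inf, ← κ.mem_iff, ← κ.mem_iff, h, mem_tLattice_succ, h', LinearMap.mem_ker,
    LinearMap.comp_apply]

theorem KricheverTrivialization.H0_eq_inf_ker (i : ℤ) : (M.E i).H0 =
    (M.E (i + 1)).H0 ⊓ LinearMap.ker (coeffHom (-(M.E i).eulerChar) ∘ₗ κ.φ) := by
  ext v
  have h := SetLike.ext_iff.mp (κ.fibre_eq_inf_ker i) v
  rw [Submodule.mem_inf] at h ⊢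
  simp only [FormalSheaf.mem_H0]
  refine ⟨fun hv => ⟨fun x => FormalSheaf.fibre_mono (M.le_succ i x) (hv x), (h.mp (hv P)).2⟩,
    fun hv x => ?_⟩
  by_cases hx : x = P
  · subst hx
    exact h.mpr ⟨hv.1 x, hv.2⟩
  · rw [M.fibre_eq i hx, ← M.fibre_eq (i + 1) hx]
    exact hv.1 x

theorem KricheverTrivialization.finite_H0_succ_iff (i : ℤ) :
    Module.Finite ℂ (M.E (i + 1)).H0 ↔ Module.Finite ℂ (M.E i).H0 := by
  constructor
  · intro h
    exact Submodule.finiteDimensional_of_le ((κ.H0_eq_inf_ker i).le.trans inf_le_left)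
  · intro h
    obtain ⟨u, -, hu⟩ := exists_le_span_sup_ker (M.E (i + 1)).H0
      (coeffHom (-(M.E i).eulerChar) ∘ₗ κ.φ)
    rw [← κ.H0_eq_inf_ker] at hu
    exact Submodule.finiteDimensional_of_le hu

theorem KricheverTrivialization.finite_H1_succ_iff (i : ℤ) :
    Module.Finite ℂ (M.E (i + 1)).H1 ↔ Module.Finite ℂ (M.E i).H1 := by
  classical
  have hR : (M.E (i + 1)).repart = (M.E i).repart :=
    FormalSheaf.repart_congr fun x hx => by rw [M.fibre_eq _ hx, M.fibre_eq i hx]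
  constructor
  · intro h
    obtain ⟨U, hU, -, hRU⟩ := exists_fg_of_finite_quotient h
    obtain ⟨u, -, hu⟩ := exists_le_span_sup_ker ((M.E (i + 1)).fibre P)
      (coeffHom (-(M.E i).eulerChar) ∘ₗ κ.φ)
    rw [← κ.fibre_eq_inf_ker] at hu
    refine finite_quotient_of_fg
      (U := U ⊔ (Submodule.span ℂ {u}).map (LinearMap.single ℂ (fun _ => Fin n → X.K) P))
      (hU.sup (Submodule.FG.map _ ⟨{u}, by simp⟩)) (hR.ge.trans (hRU.trans ?_))
    rw [sup_assoc]
    refine sup_le_sup_left ?_ _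
    rw [← sup_assoc]
    refine sup_le_sup_right (fun r hr => ?_) _
    rw [FormalSheaf.mem_integralRepart] at hr
    obtain ⟨a, ha, b, hb, hab⟩ := Submodule.mem_sup.mp (hu (hr P))
    rw [← add_sub_cancel (LinearMap.single ℂ (fun _ => Fin n → X.K) P a) r]
    refine Submodule.add_mem_sup (Submodule.mem_map_of_mem ha) ?_
    rw [FormalSheaf.mem_integralRepart]
    intro x
    by_cases hx : x = P
    · subst hx
      simpa [← hab] using hb
    · simpa [hx, M.fibre_eq i hx, ← M.fibre_eq (i + 1) hx] using hr x
  · intro h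
    obtain ⟨U, hU, -, hRU⟩ := exists_fg_of_finite_quotient h
    refine finite_quotient_of_fg hU (hR.le.trans (hRU.trans (sup_le_sup_left
      (sup_le_sup_right (fun r hr => ?_) _) _)))
    rw [FormalSheaf.mem_integralRepart] at hr ⊢
    exact fun x => FormalSheaf.fibre_mono (M.le_succ i x) (hr x)

/-- The groups `H⁰(E_i)` are finite-dimensional.  This is part of the hypothesis that `χ` increases by
one along the chain: if `H⁰` were infinite-dimensional for one of the `E_i`, it would be so for all of
them, and `finrank` would give `χ(E_i) ≤ 0` for all `i`, while `χ(E_i) = χ(E_0) + i`. -/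
theorem KricheverTrivialization.finite_H0 (i : ℤ) : Module.Finite ℂ (M.E i).H0 := by
  by_contra h
  have hall : ∀ j, ¬ Module.Finite ℂ (M.E j).H0 := fun j => by
    induction j using Int.inductionOn' (b := i) with
    | zero => exact h
    | succ k _ ih => rwa [κ.finite_H0_succ_iff]
    | pred k _ ih => rwa [← κ.finite_H0_succ_iff, sub_add_cancel]
  have h1 := M.eulerChar_eq (1 - (M.E 0).eulerChar)
  rw [FormalSheaf.eulerChar, Module.finrank_of_not_finite (hall _)] at h1
  lia

/-- The groups `H¹(E_i)` are finite-dimensional: otherwise `finrank` would give `χ(E_i) ≥ 0` for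
all `i`, while `χ(E_i) = χ(E_0) + i`. -/
theorem KricheverTrivialization.finite_H1 (i : ℤ) : Module.Finite ℂ (M.E i).H1 := by
  by_contra h
  have hall : ∀ j, ¬ Module.Finite ℂ (M.E j).H1 := fun j => by
    induction j using Int.inductionOn' (b := i) with
    | zero => exact h
    | succ k _ ih => rwa [κ.finite_H1_succ_iff]
    | pred k _ ih => rwa [← κ.finite_H1_succ_iff, sub_add_cancel]
  have h1 := M.eulerChar_eq (-1 - (M.E 0).eulerChar)
  have h2 : Module.finrank ℂ (M.E (-1 - (M.E 0).eulerChar)).H1 = 0 :=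
    finrank_eq_zero_of_not_finite (hall _)
  rw [FormalSheaf.eulerChar, h2] at h1
  lia

/-- The image of `φ` is dense: since `E_i` and `E_{i+1}` differ at `P`, every integer is the order of
some `φ(v)`. -/
theorem KricheverTrivialization.exists_sub_mem_tLattice (m : ℤ) (g : Laurent) :
    ∃ v, g - κ.φ v ∈ tLattice m := by
  obtain ⟨k, hk⟩ := exists_mem_tLattice g
  suffices H : ∀ j : ℕ, ∃ v, g - κ.φ v ∈ tLattice (k + j) by
    obtain ⟨v, hv⟩ := H (m - k).toNat
    exact ⟨v, tLattice_antitone (by lia) hv⟩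
  intro j
  induction j with
  | zero => exact ⟨0, by simpa using hk⟩
  | succ j ih =>
    obtain ⟨v, hv⟩ := ih
    set i : ℤ := -(k + j) - (M.E 0).eulerChar with hi
    have hχ : (M.E i).eulerChar = -(k + j) := by rw [M.eulerChar_eq, hi]; ring
    obtain ⟨u, hu, hu'⟩ := SetLike.exists_of_lt ((M.gr_invertible i).fibre_lt (M.le_succ i))
    have hu1 : κ.φ u ∈ tLattice (k + j) := by
      rw [← κ.mem_iff, M.eulerChar_succ, hχ] at hu
      simpa using hu
    have hc : coeffHom (k + j) (κ.φ u) ≠ 0 := fun h0 => by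
      rw [κ.fibre_eq_inf_ker, Submodule.mem_inf, hχ, neg_neg] at hu'
      exact hu' ⟨hu, h0⟩
    set c := coeffHom (k + j) (g - κ.φ v) / coeffHom (k + j) (κ.φ u)
    refine ⟨v + c • u, ?_⟩
    rw [map_add, map_smul, ← sub_sub, Nat.cast_succ, ← add_assoc, mem_tLattice_succ]
    refine ⟨sub_mem hv (Submodule.smul_mem _ _ hu1), ?_⟩
    rw [map_sub, map_smul, smul_eq_mul, div_mul_cancel₀ _ hc, sub_self]

end Oper

/-! ### Injectivity of the Krichever trivialization -/

section Injective

variable {X : CompleteCurve} {P : X.Pt} {n : ℕ}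

/-- A section cannot be infinitely divisible by an element of the maximal ideal (Krull's
intersection theorem). -/
theorem FormalSheaf.eq_zero_of_forall_inv_pow_smul_mem (E : FormalSheaf X n) {x : X.Pt} {g : X.O x}
    (hg : g ∈ IsLocalRing.maximalIdeal (X.O x)) (hg0 : g ≠ 0) {v : Fin n → X.K}
    (hv : ∀ k : ℕ, ((algebraMap (X.O x) X.K g)⁻¹ ^ k) • v ∈ E.fibre x) : v = 0 := by
  obtain ⟨d, hd, h⟩ := E.exists_denominator x
  have inj : Function.Injective (algebraMap (X.O x) X.K) := IsFractionRing.injective _ _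
  have hgK : algebraMap (X.O x) X.K g ≠ 0 := (map_ne_zero_iff _ inj).mpr hg0
  ext j
  obtain ⟨b, hb⟩ := h _ (hv 0) j
  rw [pow_zero, one_smul] at hb
  have hmem : b ∈ ⨅ k : ℕ, IsLocalRing.maximalIdeal (X.O x) ^ k := by
    rw [Submodule.mem_iInf]
    intro k
    obtain ⟨c, hc⟩ := h _ (hv k) j
    have hbc : b = g ^ k * c := by
      apply inj
      rw [map_mul, map_pow, hc, hb, Pi.smul_apply, smul_eq_mul, mul_left_comm, inv_pow,
        mul_inv_cancel_left₀ (pow_ne_zero k hgK)]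
    rw [hbc]
    exact Ideal.mul_mem_right _ _ (Ideal.pow_mem_pow hg k)
  rw [Ideal.iInf_pow_eq_bot_of_isLocalRing _ (IsLocalRing.maximalIdeal.isMaximal _).ne_top] at hmem
  rw [Ideal.mem_bot.mp hmem, map_zero, eq_comm, mul_eq_zero, map_eq_zero_iff _ inj] at hb
  exact hb.resolve_left hd

/-- There is a nonzero section over `X ∖ P`, because `χ(E_i) = 1` for some `i`. -/
theorem LocalAffineOper.exists_mem_sectionsAway_ne_zero (M : LocalAffineOper X P n) :
    ∃ v ∈ (M.E 0).sectionsAway P, v ≠ 0 := by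
  have h1 := M.eulerChar_eq (1 - (M.E 0).eulerChar)
  rw [FormalSheaf.eulerChar] at h1
  have h2 : 0 < Module.finrank ℂ (M.E (1 - (M.E 0).eulerChar)).H0 := by lia
  have := Module.nontrivial_of_finrank_pos h2
  obtain ⟨v, hv⟩ := exists_ne (0 : (M.E (1 - (M.E 0).eulerChar)).H0)
  refine ⟨v, FormalSheaf.mem_sectionsAway.mpr fun x hx => ?_, fun h => hv (Subtype.ext h)⟩
  rw [← M.fibre_eq _ hx]
  exact FormalSheaf.mem_H0.mp v.2 x

variable {M : LocalAffineOper X P n} (κ : KricheverTrivialization M)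
include κ

theorem KricheverTrivialization.f_ne_zero (hP : X.IsSmoothPt P) : κ.f ≠ 0 := by
  obtain ⟨ϖ, hm, hϖ⟩ := κ.f_uniformizer
  have := hP.not_a_field'
  rintro h0
  rw [← hϖ, map_eq_zero_iff _ (IsFractionRing.injective _ _)] at h0
  rw [hm, h0] at this
  simp at this

theorem KricheverTrivialization.inv_f_ne_algebraMap (hP : X.IsSmoothPt P) (c : ℂ) :
    κ.f⁻¹ ≠ algebraMap ℂ X.K c := by
  intro h
  obtain ⟨ϖ, hm, hϖ⟩ := κ.f_uniformizer
  have h1 : ϖ * X.constAt P c = 1 := by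
    apply IsFractionRing.injective (X.O P) X.K
    rw [map_mul, algebraMap_constAt, hϖ, ← h, mul_inv_cancel₀ (κ.f_ne_zero hP), map_one]
  refine (IsLocalRing.maximalIdeal.isMaximal (X.O P)).ne_top ?_
  rw [Ideal.eq_top_iff_one, ← h1]
  exact Ideal.mul_mem_right _ _ (hm ▸ Ideal.mem_span_singleton_self ϖ)

theorem KricheverTrivialization.map_inv_f_smul (hP : X.IsSmoothPt P) (v : Fin n → X.K) :
    κ.φ (κ.f⁻¹ • v) = tPow (-n) (κ.φ v) := by
  have h := κ.map_f_mul (κ.f⁻¹ • v)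
  have h2 : (fun j => κ.f * (κ.f⁻¹ • v) j) = v := by
    ext j
    rw [Pi.smul_apply, smul_eq_mul, mul_inv_cancel_left₀ (κ.f_ne_zero hP)]
  rw [← h2, h, tPow_tPow, neg_add_cancel, tPow_zero, h2]

/-- If `φ(v) = 0`, then `f ^ (-k) v` lies in the stalk of `E` at `P` for all `k`, so `v = 0`. -/
theorem KricheverTrivialization.φ_injective (hP : X.IsSmoothPt P) : Function.Injective κ.φ := by
  rw [injective_iff_map_eq_zero]
  intro v hv
  obtain ⟨ϖ, hm, hϖ⟩ := κ.f_uniformizer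
  have hϖ0 : ϖ ≠ 0 := fun h0 => κ.f_ne_zero hP (by rw [← hϖ, h0, map_zero])
  refine (M.E 0).eq_zero_of_forall_inv_pow_smul_mem (g := ϖ)
    (hm ▸ Ideal.mem_span_singleton_self ϖ) hϖ0 fun k => ?_
  rw [hϖ, ← κ.mem_iff]
  suffices h : κ.φ (κ.f⁻¹ ^ k • v) = 0 by rw [h]; exact zero_mem _
  induction k with
  | zero => simpa using hv
  | succ k ih => rw [pow_succ', mul_smul, κ.map_inv_f_smul hP, ih, map_zero]

/-- For `n`-reduced `W`, the sections over `X ∖ P` are stable under multiplication by `f⁻¹`. -/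
theorem KricheverTrivialization.inv_f_pow_smul_mem (hP : X.IsSmoothPt P)
    (hred : κ.image.map (tPow (-n)) ≤ κ.image) {v : Fin n → X.K}
    (hv : v ∈ (M.E 0).sectionsAway P) (k : ℕ) : κ.f⁻¹ ^ k • v ∈ (M.E 0).sectionsAway P := by
  induction k with
  | zero => simpa using hv
  | succ k ih =>
    obtain ⟨w, hw, hwe⟩ := hred ⟨_, ⟨_, ih, rfl⟩, rfl⟩
    rw [← κ.map_inv_f_smul hP] at hwe
    rw [pow_succ', mul_smul, ← κ.φ_injective hP hwe]
    exact hw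

/-- All powers of `f⁻¹` have a common denominator at each point `x` other than `P`: if `v ≠ 0` is a
section over `X ∖ P`, all `f⁻¹ ^ k v` lie in the finitely generated stalk `E_x`. -/
theorem KricheverTrivialization.exists_mul_inv_f_pow_mem (hP : X.IsSmoothPt P)
    (hred : κ.image.map (tPow (-n)) ≤ κ.image) {x : X.Pt} (hx : x ≠ P) :
    ∃ a : X.O x, a ≠ 0 ∧
      ∀ k : ℕ, algebraMap (X.O x) X.K a * κ.f⁻¹ ^ k ∈ (algebraMap (X.O x) X.K).range := by
  obtain ⟨v, hv, hv0⟩ := M.exists_mem_sectionsAway_ne_zero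
  obtain ⟨j, hj⟩ := Function.ne_iff.mp hv0
  obtain ⟨d, hd, h⟩ := (M.E 0).exists_denominator x
  have inj : Function.Injective (algebraMap (X.O x) X.K) := IsFractionRing.injective _ _
  have hk := fun k : ℕ =>
    h _ (FormalSheaf.mem_sectionsAway.mp (κ.inv_f_pow_smul_mem hP hred hv k) x hx) j
  obtain ⟨a, ha⟩ := hk 0
  rw [pow_zero, one_smul] at ha
  refine ⟨a, ?_, fun k => ?_⟩
  · rintro rfl
    rw [map_zero, eq_comm, mul_eq_zero, map_eq_zero_iff _ inj] at ha
    exact ha.elim hd hj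
  · have := hk k
    rwa [Pi.smul_apply, smul_eq_mul, mul_left_comm, ← ha, mul_comm] at this

end Injective

/-! ### Vanishing of `H¹` on the complement of `P` -/

section Vanishing

variable {X : CompleteCurve} {P : X.Pt} {n : ℕ}

/-- The largest subspace of the stalk of `E` at `x` which is stable under multiplication by the
rational function `y`. -/
def FormalSheaf.stableFibre (E : FormalSheaf X n) (y : X.K) (x : X.Pt) :
    Submodule ℂ (Fin n → X.K) where
  carrier := {v | ∀ k : ℕ, y ^ k • v ∈ E.fibre x}
  zero_mem' k := by rw [smul_zero]; exact zero_mem _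
  add_mem' ha hb k := by rw [smul_add]; exact add_mem (ha k) (hb k)
  smul_mem' c _ ha k := by rw [smul_comm]; exact Submodule.smul_mem _ c (ha k)

theorem FormalSheaf.stableFibre_le (E : FormalSheaf X n) (y : X.K) (x : X.Pt) :
    E.stableFibre y x ≤ E.fibre x := fun v hv => by simpa using hv 0

theorem FormalSheaf.smul_mem_stableFibre {E : FormalSheaf X n} {y : X.K} {x : X.Pt}
    {v : Fin n → X.K} (hv : v ∈ E.stableFibre y x) : y • v ∈ E.stableFibre y x := fun k => by
  rw [smul_smul, ← pow_succ]
  exact hv (k + 1)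

theorem FormalSheaf.fibre_genericPoint (E : FormalSheaf X n) :
    E.fibre (genericPoint X.scheme) = ⊤ := by
  rw [eq_top_iff]
  intro w _
  refine ⟨fun j => PowerSeries.C (w j), by rw [E.generic]; trivial, fun j => by simp⟩

theorem FormalSheaf.fibre_le_stableFibre (E : FormalSheaf X n) {y : X.K} {x : X.Pt}
    (hy : y ∈ (algebraMap (X.O x) X.K).range) : E.fibre x ≤ E.stableFibre y x := fun _ hv k =>
  E.mul_mem_fibre (pow_mem hy k) hv

/-- If the powers of `y` have a common denominator `a` at `x`, the stable part of `E_x` contains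
`a E_x` and has finite codimension. -/
theorem FormalSheaf.exists_fg_fibre_le_stableFibre (E : FormalSheaf X n) {y : X.K} {x : X.Pt}
    {a : X.O x} (ha : a ≠ 0)
    (hay : ∀ k : ℕ, algebraMap (X.O x) X.K a * y ^ k ∈ (algebraMap (X.O x) X.K).range) :
    ∃ U : Submodule ℂ (Fin n → X.K), U.FG ∧ E.fibre x ≤ U ⊔ E.stableFibre y x := by
  by_cases hx : x = genericPoint X.scheme
  · subst hx
    refine ⟨⊥, Submodule.fg_bot, fun v _ => Submodule.mem_sup_right fun k => ?_⟩
    rw [E.fibre_genericPoint]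
    trivial
  · obtain ⟨U, hU, -, h⟩ := E.exists_fg_fibre hx ha
    refine ⟨U, hU, fun e he => ?_⟩
    obtain ⟨u, hu, e', he', rfl⟩ := h e he
    refine Submodule.add_mem_sup hu fun k => ?_
    rw [smul_smul, mul_comm]
    exact E.mul_mem_fibre (hay k) he'

theorem FormalSheaf.smul_mem_repart (E : FormalSheaf X n) (g : X.K) {r : X.Pt → Fin n → X.K}
    (hr : r ∈ E.repart) : g • r ∈ E.repart := by
  refine ((mem_repart.mp hr).union (finite_setOf_notMem_range g)).subset fun x hx => ?_
  by_contra h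
  rw [Set.mem_union, not_or] at h
  exact hx (E.mul_mem_fibre (not_not.mp h.2) (not_not.mp h.1))

theorem FormalSheaf.single_mem_repart [DecidableEq X.Pt] (E : FormalSheaf X n) (x : X.Pt)
    (v : Fin n → X.K) : Pi.single x v ∈ E.repart := by
  refine (Set.finite_singleton x).subset fun z hz => ?_
  by_contra h
  refine hz ?_
  rw [Pi.single_eq_of_ne h]
  exact zero_mem _

/-- Let `y` be a nonconstant rational function whose powers have a common denominator at each point
other than `P`.  If `H¹(X, E)` is finite-dimensional, then `H¹(X ∖ P, E') = 0` for the largest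
`y`-stable subsheaf `E'` of `E`: it is finite-dimensional, and `y - c` acts surjectively on it for
every constant `c`. -/
theorem FormalSheaf.exists_forall_sub_mem_stableFibre (E : FormalSheaf X n)
    (hE : Module.Finite ℂ E.H1) {y : X.K} (hy : ∀ c : ℂ, y ≠ algebraMap ℂ X.K c)
    (hden : ∀ x ≠ P, ∃ a : X.O x, a ≠ 0 ∧
      ∀ k : ℕ, algebraMap (X.O x) X.K a * y ^ k ∈ (algebraMap (X.O x) X.K).range)
    {r : X.Pt → Fin n → X.K} (hr : r ∈ E.repart) :
    ∃ w, ∀ x ≠ P, r x - w ∈ E.stableFibre y x := by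
  classical
  let N : Submodule ℂ (X.Pt → Fin n → X.K) := Submodule.pi {x | x ≠ P} (E.stableFibre y)
  let T : (X.Pt → Fin n → X.K) →ₗ[ℂ] (X.Pt → Fin n → X.K) := Algebra.lsmul ℂ ℂ _ y
  obtain ⟨U, hU, -, hRU⟩ := exists_fg_of_finite_quotient hE
  have hex : ∀ x, ∃ Ux : Submodule ℂ (Fin n → X.K), Ux.FG ∧
      (x ≠ P → E.fibre x ≤ Ux ⊔ E.stableFibre y x) := fun x => by
    by_cases hx : x = P
    · exact ⟨⊥, Submodule.fg_bot, fun h => absurd hx h⟩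
    · obtain ⟨a, ha, hay⟩ := hden x hx
      obtain ⟨Ux, h1, h2⟩ := E.exists_fg_fibre_le_stableFibre ha hay
      exact ⟨Ux, h1, fun _ => h2⟩
  choose Us hUs hUs' using hex
  -- `E` and its stable part agree outside of the finite set `Z ∪ {P}`; at the points of `Z` the
  -- finite-dimensional spaces `Us x` generate the quotient.
  let Z := (finite_setOf_notMem_range y).toFinset
  let U' : Submodule ℂ (X.Pt → Fin n → X.K) :=
    ⨆ x ∈ Z, (Us x).map (LinearMap.single ℂ (fun _ => Fin n → X.K) x)
  have hU' : U'.FG := Submodule.fg_biSup Z _ fun x _ => (hUs x).map _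
  have hI : E.integralRepart ≤ U' ⊔ N := by
    intro ι hι
    rw [mem_integralRepart] at hι
    have hsplit : ∀ x, ∃ u ∈ Us x, x ≠ P → ι x - u ∈ E.stableFibre y x := fun x => by
      by_cases hx : x = P
      · exact ⟨0, zero_mem _, fun h => absurd hx h⟩
      · obtain ⟨u, hu, b, hb, hub⟩ := Submodule.mem_sup.mp (hUs' x hx (hι x))
        exact ⟨u, hu, fun _ => by rw [← hub, add_sub_cancel_left]; exact hb⟩
    choose u hu hu' using hsplit
    rw [← add_sub_cancel (∑ x ∈ Z, LinearMap.single ℂ (fun _ => Fin n → X.K) x (u x)) ι]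
    refine Submodule.add_mem_sup (Submodule.sum_mem _ fun x hx => ?_) ?_
    · exact Submodule.mem_iSup_of_mem x (Submodule.mem_iSup_of_mem hx
        (Submodule.mem_map_of_mem (hu x)))
    · rw [Submodule.mem_pi]
      intro x hx
      rw [Pi.sub_apply, Finset.sum_apply]
      by_cases hxZ : x ∈ Z
      · rw [Finset.sum_eq_single x (fun z _ hz => by simp [hz.symm]) (fun h => absurd hxZ h)]
        simpa using hu' x hx
      · rw [Finset.sum_eq_zero, sub_zero]
        · refine E.fibre_le_stableFibre ?_ (hι x)
          by_contra h
          exact hxZ (by simpa [Z] using h)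
        · intro z hz
          have : x ≠ z := fun h => hxZ (h ▸ hz)
          simp [this]
  have hle : E.repart ≤ N ⊔ constRepart X n := by
    refine le_of_forall_sub_smul_surjective T (fun r hr => E.smul_mem_repart y hr) ?_ ?_
      (hU.sup hU') ?_
    · intro b hb
      obtain ⟨ν, hν, c, hc, rfl⟩ := Submodule.mem_sup.mp hb
      rw [map_add]
      refine Submodule.add_mem_sup ?_ ?_
      · rw [Submodule.mem_pi] at hν ⊢
        exact fun x hx => smul_mem_stableFibre (hν x hx)
      · rw [mem_constRepart] at hc ⊢
        obtain ⟨w, hw⟩ := hc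
        exact ⟨y • w, fun x => by rw [← hw x]; rfl⟩
    · intro c r hr
      refine ⟨(y - algebraMap ℂ X.K c)⁻¹ • r, E.smul_mem_repart _ hr, ?_⟩
      rw [← algebraMap_smul X.K c]
      change y • _ - _ = r
      rw [← sub_smul, smul_inv_smul₀ (sub_ne_zero.mpr (hy c))]
    · refine hRU.trans ?_
      rw [sup_assoc, ← sup_assoc U']
      exact sup_le_sup_left (sup_le_sup_right hI _) _
  obtain ⟨ν, hν, c, hc, rfl⟩ := Submodule.mem_sup.mp (hle hr)
  obtain ⟨w, hw⟩ := mem_constRepart.mp hc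
  refine ⟨w, fun x hx => ?_⟩
  rw [Pi.add_apply, hw x, add_sub_cancel_right]
  exact Submodule.mem_pi.mp hν x hx

variable {M : LocalAffineOper X P n} (κ : KricheverTrivialization M)
include κ

/-- The sheaf `E` on `X ∖ P` is stable under `f⁻¹`: the largest stable subsheaf `E'` has the same
sections over `X ∖ P`, and these approximate any germ of `E` modulo `E'`. -/
theorem KricheverTrivialization.inv_f_smul_mem_fibre (hP : X.IsSmoothPt P)
    (hred : κ.image.map (tPow (-n)) ≤ κ.image) {x : X.Pt} (hx : x ≠ P) {e : Fin n → X.K}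
    (he : e ∈ (M.E 0).fibre x) : κ.f⁻¹ • e ∈ (M.E 0).fibre x := by
  classical
  obtain ⟨w, hw⟩ := (M.E 0).exists_forall_sub_mem_stableFibre (κ.finite_H1 0)
    (κ.inv_f_ne_algebraMap hP) (fun x hx => κ.exists_mul_inv_f_pow_mem hP hred hx)
    ((M.E 0).single_mem_repart x e)
  have hws : w ∈ (M.E 0).sectionsAway P := by
    rw [FormalSheaf.mem_sectionsAway]
    intro z hz
    have h := (M.E 0).stableFibre_le _ z (hw z hz)
    by_cases hzx : z = x
    · subst hzx
      rw [Pi.single_eq_same] at h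
      simpa using sub_mem he h
    · rw [Pi.single_eq_of_ne hzx, zero_sub, neg_mem_iff] at h
      exact h
  have h1 := hw x hx
  rw [Pi.single_eq_same] at h1
  have h2 : w ∈ (M.E 0).stableFibre κ.f⁻¹ x := fun k =>
    FormalSheaf.mem_sectionsAway.mp (κ.inv_f_pow_smul_mem hP hred hws k) x hx
  simpa using add_mem h1 h2 1

/-- The vanishing of `H¹(X ∖ P, E)`. -/
theorem KricheverTrivialization.exists_forall_sub_mem_fibre (hP : X.IsSmoothPt P)
    (hred : κ.image.map (tPow (-n)) ≤ κ.image) {r : X.Pt → Fin n → X.K}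
    (hr : r ∈ (M.E 0).repart) : ∃ w, ∀ x ≠ P, r x - w ∈ (M.E 0).fibre x := by
  obtain ⟨w, hw⟩ := (M.E 0).exists_forall_sub_mem_stableFibre (κ.finite_H1 0)
    (κ.inv_f_ne_algebraMap hP) (fun x hx => κ.exists_mul_inv_f_pow_mem hP hred hx) hr
  exact ⟨w, fun x hx => (M.E 0).stableFibre_le _ x (hw x hx)⟩

end Vanishing

/-! ### The Krichever image and its virtual dimension -/

section VirtDim

variable {X : CompleteCurve} {P : X.Pt} {n : ℕ} {M : LocalAffineOper X P n}
  (κ : KricheverTrivialization M)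
include κ

/-- `H⁰(E_i)` is the intersection of `W` with the lattice of `E_i` at `P`. -/
theorem KricheverTrivialization.map_H0 (i : ℤ) :
    (M.E i).H0.map κ.φ = κ.image ⊓ tLattice (1 - (M.E i).eulerChar) := by
  ext g
  constructor
  · rintro ⟨v, hv, rfl⟩
    have hv := FormalSheaf.mem_H0.mp hv
    refine ⟨⟨v, FormalSheaf.mem_sectionsAway.mpr fun x hx => ?_, rfl⟩, (κ.mem_iff i v).mpr (hv P)⟩
    rw [← M.fibre_eq i hx]
    exact hv x
  · rintro ⟨⟨v, hv, rfl⟩, h⟩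
    have hv := FormalSheaf.mem_sectionsAway.mp hv
    refine ⟨v, FormalSheaf.mem_H0.mpr fun x => ?_, rfl⟩
    by_cases hx : x = P
    · subst hx
      exact (κ.mem_iff i v).mp h
    · rw [M.fibre_eq i hx]
      exact hv x hx

/-- By density of the image of `φ`, the cokernel of `W → ℂ((t)) / t ^ (1 - χ(E_i)) ℂ[[t]]` is the
quotient of `K ^ n` by the sum of `H⁰(X ∖ P, E)` and the stalk of `E_i` at `P`. -/
theorem KricheverTrivialization.nonempty_quotient_equiv (i : ℤ) :
    Nonempty (((Fin n → X.K) ⧸ ((M.E 0).sectionsAway P ⊔ (M.E i).fibre P)) ≃ₗ[ℂ]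
      Laurent ⧸ (tLattice (1 - (M.E i).eulerChar) ⊔ κ.image)) := by
  let S := tLattice (1 - (M.E i).eulerChar) ⊔ κ.image
  let ψ : (Fin n → X.K) →ₗ[ℂ] Laurent ⧸ S := S.mkQ ∘ₗ κ.φ
  have hker : (M.E 0).sectionsAway P ⊔ (M.E i).fibre P = LinearMap.ker ψ := by
    rw [LinearMap.ker_comp, Submodule.ker_mkQ]
    refine le_antisymm (sup_le (fun v hv => ?_) fun v hv => ?_) fun v hv => ?_
    · exact Submodule.mem_sup_right ⟨v, hv, rfl⟩
    · exact Submodule.mem_sup_left ((κ.mem_iff i v).mpr hv)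
    · obtain ⟨g, hg, h, ⟨w, hw, rfl⟩, hgh⟩ := Submodule.mem_sup.mp hv
      rw [← add_sub_cancel w v]
      refine Submodule.add_mem_sup hw ((κ.mem_iff i _).mp ?_)
      rw [map_sub, ← hgh, add_sub_cancel_right]
      exact hg
  have hsurj : Function.Surjective ψ := by
    intro q
    obtain ⟨g, rfl⟩ := S.mkQ_surjective q
    obtain ⟨v, hv⟩ := κ.exists_sub_mem_tLattice (1 - (M.E i).eulerChar) g
    refine ⟨v, Eq.symm ?_⟩
    rw [← sub_eq_zero]
    exact (Submodule.Quotient.mk_eq_zero S).mpr (Submodule.mem_sup_left hv)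
  exact ⟨Submodule.quotEquivOfEq _ _ hker ≪≫ₗ ψ.quotKerEquivOfSurjective hsurj⟩

/-- `H¹(E_i)` consists of the classes of the répartitions which vanish outside of `P`, because
`H¹(X ∖ P, E) = 0`. -/
theorem KricheverTrivialization.nonempty_H1_equiv (hP : X.IsSmoothPt P)
    (hred : κ.image.map (tPow (-n)) ≤ κ.image) (i : ℤ) :
    Nonempty (((Fin n → X.K) ⧸ ((M.E 0).sectionsAway P ⊔ (M.E i).fibre P)) ≃ₗ[ℂ] (M.E i).H1) := by
  classical
  let R := (M.E i).repart
  let S := ((M.E i).integralRepart ⊔ constRepart X n).submoduleOf R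
  let s : (Fin n → X.K) →ₗ[ℂ] R := (LinearMap.single ℂ (fun _ : X.Pt => Fin n → X.K) P).codRestrict
    R fun v => (M.E i).single_mem_repart P v
  let ψ : (Fin n → X.K) →ₗ[ℂ] ↥R ⧸ S := S.mkQ ∘ₗ s
  have hker : (M.E 0).sectionsAway P ⊔ (M.E i).fibre P = LinearMap.ker ψ := by
    rw [LinearMap.ker_comp, Submodule.ker_mkQ]
    refine le_antisymm (sup_le (fun v hv => ?_) fun v hv => ?_) fun v hv => ?_
    · change Pi.single P v ∈ (M.E i).integralRepart ⊔ constRepart X n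
      rw [← sub_add_cancel (Pi.single P v) (fun _ => v)]
      refine Submodule.add_mem_sup (FormalSheaf.mem_integralRepart.mpr fun x => ?_)
        (mem_constRepart.mpr ⟨v, fun _ => rfl⟩)
      by_cases hx : x = P
      · subst hx
        simp
      · simpa [hx, M.fibre_eq i hx] using FormalSheaf.mem_sectionsAway.mp hv x hx
    · change Pi.single P v ∈ (M.E i).integralRepart ⊔ constRepart X n
      refine Submodule.mem_sup_left (FormalSheaf.mem_integralRepart.mpr fun x => ?_)
      by_cases hx : x = P
      · subst hx
        simpa using hv
      · simp [hx]
    · obtain ⟨ι, hι, c, hc, h⟩ := Submodule.mem_sup.mp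
        (show Pi.single P v ∈ (M.E i).integralRepart ⊔ constRepart X n from hv)
      obtain ⟨w, hw⟩ := mem_constRepart.mp hc
      rw [FormalSheaf.mem_integralRepart] at hι
      have hx : ∀ x, ι x + w = (Pi.single P v : X.Pt → Fin n → X.K) x := fun x => by
        rw [← h, Pi.add_apply, hw]
      rw [← add_sub_cancel w v]
      refine Submodule.add_mem_sup (FormalSheaf.mem_sectionsAway.mpr fun x hxP => ?_) ?_
      · have h1 := hx x
        rw [Pi.single_eq_of_ne hxP, add_comm, add_eq_zero_iff_eq_neg] at h1
        rw [h1, neg_mem_iff, ← M.fibre_eq i hxP]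
        exact hι x
      · have h1 := hx P
        rw [Pi.single_eq_same] at h1
        rw [← h1, add_sub_cancel_right]
        exact hι P
  have hsurj : Function.Surjective ψ := by
    intro q
    obtain ⟨⟨r, hr⟩, rfl⟩ := S.mkQ_surjective q
    have hr0 : r ∈ (M.E 0).repart := by
      rwa [← FormalSheaf.repart_congr (E := M.E i) fun x hx => M.fibre_eq i hx]
    obtain ⟨w, hw⟩ := κ.exists_forall_sub_mem_fibre hP hred hr0
    refine ⟨r P - w, Eq.symm ?_⟩
    rw [← sub_eq_zero]
    refine (Submodule.Quotient.mk_eq_zero S).mpr ?_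
    let p : X.Pt → Fin n → X.K := Pi.single P (r P - w)
    change r - p ∈ (M.E i).integralRepart ⊔ constRepart X n
    rw [← sub_add_cancel (r - p) (fun _ => w)]
    refine Submodule.add_mem_sup (FormalSheaf.mem_integralRepart.mpr fun x => ?_)
      (mem_constRepart.mpr ⟨w, fun _ => rfl⟩)
    by_cases hx : x = P
    · subst hx
      simp [p]
    · simpa [p, hx, M.fibre_eq i hx] using hw x hx
  exact ⟨Submodule.quotEquivOfEq _ _ hker ≪≫ₗ ψ.quotKerEquivOfSurjective hsurj⟩

/-- The index of `t ^ m W` is the Euler characteristic of the `E_i` with `χ(E_i) = m`. -/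
theorem KricheverTrivialization.isFredholm_and_virtDim_map_tPow (hP : X.IsSmoothPt P)
    (hred : κ.image.map (tPow (-n)) ≤ κ.image) (m : ℤ) :
    IsFredholm (κ.image.map (tPow m)) ∧ virtDim (κ.image.map (tPow m)) = m := by
  have hχ := M.eulerChar_eq (m - (M.E 0).eulerChar)
  rw [add_sub_cancel] at hχ
  obtain ⟨e⟩ := κ.nonempty_quotient_equiv (m - (M.E 0).eulerChar)
  obtain ⟨e'⟩ := κ.nonempty_H1_equiv hP hred (m - (M.E 0).eulerChar)
  have h0 : (M.E (m - (M.E 0).eulerChar)).H0 ≃ₗ[ℂ] ↥(κ.image.map (tPow m) ⊓ tLattice 1) :=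
    Submodule.equivMapOfInjective κ.φ (κ.φ_injective hP) _ ≪≫ₗ
      LinearEquiv.ofEq _ _ (by rw [κ.map_H0, hχ]) ≪≫ₗ kerShiftEquiv κ.image m
  have h1 : (M.E (m - (M.E 0).eulerChar)).H1 ≃ₗ[ℂ]
      Laurent ⧸ (tLattice 1 ⊔ κ.image.map (tPow m)) :=
    e'.symm ≪≫ₗ e ≪≫ₗ Submodule.quotEquivOfEq _ _ (by rw [hχ]) ≪≫ₗ cokerShiftEquiv κ.image m
  have hf0 := κ.finite_H0 (m - (M.E 0).eulerChar)
  have hf1 := κ.finite_H1 (m - (M.E 0).eulerChar)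
  refine ⟨isFredholm_iff.mpr ⟨Module.Finite.equiv h0, Module.Finite.equiv h1⟩, ?_⟩
  rw [virtDim_eq, ← h0.finrank_eq, ← h1.finrank_eq]
  exact hχ

theorem KricheverTrivialization.isFredholm_image (hP : X.IsSmoothPt P)
    (hred : κ.image.map (tPow (-n)) ≤ κ.image) : IsFredholm κ.image ∧ virtDim κ.image = 0 := by
  have h0 : tPow 0 = LinearMap.id := LinearMap.ext tPow_zero
  simpa [h0] using κ.isFredholm_and_virtDim_map_tPow hP hred 0

end VirtDim

theorem add_le_apply_of_strictMono {n : ℕ} {g : Fin (n + 1) → ℤ} (hg : StrictMono g)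
    (i : Fin (n + 1)) : g 0 + (i : ℕ) ≤ g i := by
  induction i using Fin.induction with
  | zero => simp
  | succ i ih =>
    have := hg i.castSucc_lt_succ
    simp only [Fin.val_succ, Fin.val_castSucc] at *
    lia

/-- A strictly increasing sequence of `n + 1` integers between `-n` and `0` is `i ↦ i - n`. -/
theorem eq_sub_of_strictMono {n : ℕ} {g : Fin (n + 1) → ℤ} (hg : StrictMono g)
    (h0 : g 0 = -n) (hn : g (Fin.last n) ≤ 0) (i : Fin (n + 1)) : g i = (i : ℕ) - (n : ℤ) := by
  have h1 := add_le_apply_of_strictMono hg i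
  have h2 : g i + (n - (i : ℕ)) ≤ g (Fin.last n) := by
    clear h1
    induction i using Fin.reverseInduction with
    | last => simp
    | cast i ih =>
      have := hg i.castSucc_lt_succ
      simp only [Fin.val_succ, Fin.val_castSucc] at *
      lia
  lia

/-! ### The flag at `Q` -/

section Flag

variable {X : CompleteCurve} {P Q : X.Pt} {n : ℕ} (M : LocalAffineMiuraOper X P Q n)

theorem LocalAffineMiuraOper.fibre_eq' (i : Fin (n + 1)) {x : X.Pt} (hx : x ≠ Q) :
    (M.E' i).fibre x = (M.E 0).fibre x := by
  induction i using Fin.induction with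
  | zero => rw [M.zero_eq]
  | succ i ih => rw [← ih, FormalSheaf.fibre_congr ((M.gr_invertible' i).1 x hx)]

theorem LocalAffineMiuraOper.strictMono_fibre : StrictMono fun i => (M.E' i).fibre Q :=
  Fin.strictMono_iff_lt_succ.mpr fun i => (M.gr_invertible' i).fibre_lt (M.le_succ' i)

theorem LocalAffineMiuraOper.mem_sectionsAway' (hPQ : P ≠ Q) {i : Fin (n + 1)} {v : Fin n → X.K} :
    v ∈ (M.E' i).sectionsAway P ↔
      v ∈ (M.E' i).fibre Q ∧ ∀ x, x ≠ P → x ≠ Q → v ∈ (M.E 0).fibre x := by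
  rw [FormalSheaf.mem_sectionsAway]
  refine ⟨fun h => ⟨h Q hPQ.symm, fun x hxP hxQ => M.fibre_eq' i hxQ ▸ h x hxP⟩, fun h x hx => ?_⟩
  by_cases hxQ : x = Q
  · exact hxQ ▸ h.1
  · exact M.fibre_eq' i hxQ ▸ h.2 x hx hxQ

variable {M} (κ : KricheverTrivialization M.toLocalAffineOper)

/-- The subspaces `t ^ (-n) φ(H⁰(X ∖ P, E'_i))`, which will turn out to be the affine flag with
`F_n = W`. -/
def kricheverFlag (i : Fin (n + 1)) : Submodule ℂ Laurent :=
  ((M.E' i).sectionsAway P).map (tPow (-n) ∘ₗ κ.φ)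


theorem kricheverFlag_zero : kricheverFlag κ 0 = κ.image.map (tPow (-n)) := by
  rw [kricheverFlag, M.zero_eq, Submodule.map_comp]
  rfl

theorem injective_tPow_comp (hP : X.IsSmoothPt P) :
    Function.Injective (tPow (-n) ∘ₗ κ.φ) :=
  (tPowEquiv (-n)).injective.comp (κ.φ_injective hP)

/-- Sections of `E'_n` over `X ∖ P` represent every class in `E'_n / E'_0`, because
`H¹(X ∖ P, E) = 0`. -/
theorem exists_mem_sectionsAway_sub_mem (hP : X.IsSmoothPt P) (hPQ : P ≠ Q)
    (hred : κ.image.map (tPow (-n)) ≤ κ.image) {i : Fin (n + 1)} {e : Fin n → X.K}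
    (he : e ∈ (M.E' i).fibre Q) :
    ∃ w ∈ (M.E' i).sectionsAway P, e - w ∈ (M.E' 0).fibre Q := by
  classical
  obtain ⟨w, hw⟩ := κ.exists_forall_sub_mem_fibre hP hred ((M.E 0).single_mem_repart Q e)
  have h1 := hw Q hPQ.symm
  rw [Pi.single_eq_same, ← M.zero_eq] at h1
  refine ⟨w, (M.mem_sectionsAway' hPQ).mpr ⟨?_, fun x hxP hxQ => ?_⟩, h1⟩
  · simpa using sub_mem he (M.strictMono_fibre.monotone (Fin.zero_le i) h1)
  · have h2 := hw x hxP
    rwa [Pi.single_eq_of_ne hxQ, zero_sub, neg_mem_iff] at h2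

theorem sectionsAway_strictMono (hP : X.IsSmoothPt P) (hPQ : P ≠ Q)
    (hred : κ.image.map (tPow (-n)) ≤ κ.image) :
    StrictMono fun i => (M.E' i).sectionsAway P := by
  intro i j hij
  refine lt_of_le_not_ge (fun v hv => ?_) fun hle => ?_
  · obtain ⟨h1, h2⟩ := (M.mem_sectionsAway' hPQ).mp hv
    exact (M.mem_sectionsAway' hPQ).mpr ⟨(M.strictMono_fibre hij).le h1, h2⟩
  · obtain ⟨e, he, he'⟩ := SetLike.exists_of_lt (M.strictMono_fibre hij)
    obtain ⟨w, hw, hew⟩ := exists_mem_sectionsAway_sub_mem κ hP hPQ hred he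
    refine he' ?_
    rw [← sub_add_cancel e w]
    exact add_mem (M.strictMono_fibre.monotone (Fin.zero_le i) hew)
      ((M.mem_sectionsAway' hPQ).mp (hle hw)).1

theorem kricheverFlag_strictMono (hP : X.IsSmoothPt P) (hPQ : P ≠ Q)
    (hred : κ.image.map (tPow (-n)) ≤ κ.image) : StrictMono (kricheverFlag κ) :=
  (Submodule.map_strictMono_of_injective (injective_tPow_comp κ hP)).comp
    (sectionsAway_strictMono κ hP hPQ hred)

/-- Since `f⁻¹` vanishes at `Q`, multiplication by it takes `E'_n = E(Q)` to `E`. -/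
theorem kricheverFlag_last_le (hP : X.IsSmoothPt P) (hPQ : P ≠ Q)
    (hred : κ.image.map (tPow (-n)) ≤ κ.image)
    (hfQ : ∃ g ∈ IsLocalRing.maximalIdeal (X.O Q), algebraMap (X.O Q) X.K g = κ.f⁻¹) :
    kricheverFlag κ (Fin.last n) ≤ κ.image := by
  rintro _ ⟨v, hv, rfl⟩
  obtain ⟨hvQ, hv'⟩ := (M.mem_sectionsAway' hPQ).mp hv
  refine ⟨κ.f⁻¹ • v, FormalSheaf.mem_sectionsAway.mpr fun x hx => ?_, κ.map_inv_f_smul hP v⟩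
  by_cases hxQ : x = Q
  · subst hxQ
    obtain ⟨g, hg, hgf⟩ := hfQ
    obtain ⟨u, hu, huv⟩ := hvQ
    rw [← M.zero_eq, ← hgf, algebraMap_smul]
    have h := FormalSheaf.mem_stalkMod.mp (Submodule.mem_map_of_mem (f := reduction x)
      ((M.isTwist'.2 u).mp hu g hg))
    rwa [map_smulₛₗ, PowerSeries.constantCoeff_C, show reduction x u = v from funext huv] at h
  · exact κ.inv_f_smul_mem_fibre hP hred hx (hv' x hx hxQ)

theorem isFredholm_kricheverFlag (hP : X.IsSmoothPt P) (hPQ : P ≠ Q)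
    (hred : κ.image.map (tPow (-n)) ≤ κ.image)
    (hfQ : ∃ g ∈ IsLocalRing.maximalIdeal (X.O Q), algebraMap (X.O Q) X.K g = κ.f⁻¹)
    (i : Fin (n + 1)) : IsFredholm (kricheverFlag κ i) := by
  have hmono := (kricheverFlag_strictMono κ hP hPQ hred).monotone
  refine (κ.isFredholm_and_virtDim_map_tPow hP hred (-n)).1.of_le_of_le
    (κ.isFredholm_image hP hred).1 ?_
    ((hmono (Fin.le_last i)).trans (kricheverFlag_last_le κ hP hPQ hred hfQ))
  rw [← kricheverFlag_zero]
  exact hmono (Fin.zero_le i)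

/-- The virtual dimensions of `F_0 ⊂ ⋯ ⊂ F_n ⊆ W` increase strictly from `-n` to at most `0`. -/
theorem virtDim_kricheverFlag (hP : X.IsSmoothPt P) (hPQ : P ≠ Q)
    (hred : κ.image.map (tPow (-n)) ≤ κ.image)
    (hfQ : ∃ g ∈ IsLocalRing.maximalIdeal (X.O Q), algebraMap (X.O Q) X.K g = κ.f⁻¹)
    (i : Fin (n + 1)) : virtDim (kricheverFlag κ i) = (i : ℕ) - (n : ℤ) := by
  have hF := isFredholm_kricheverFlag κ hP hPQ hred hfQ
  refine eq_sub_of_strictMono (g := fun i => virtDim (kricheverFlag κ i)) (fun i j hij =>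
    virtDim_lt (hF i) (hF j) (kricheverFlag_strictMono κ hP hPQ hred hij)) ?_ ?_ i
  · rw [kricheverFlag_zero, (κ.isFredholm_and_virtDim_map_tPow hP hred (-n)).2]
  · obtain ⟨h1, h2⟩ := κ.isFredholm_image hP hred
    exact h2 ▸ virtDim_mono (hF _) h1 (kricheverFlag_last_le κ hP hPQ hred hfQ)

/-- The inclusion `F_n ⊆ W` is an equality, because both sides have virtual dimension zero. -/
theorem kricheverFlag_last (hP : X.IsSmoothPt P) (hPQ : P ≠ Q)
    (hred : κ.image.map (tPow (-n)) ≤ κ.image)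
    (hfQ : ∃ g ∈ IsLocalRing.maximalIdeal (X.O Q), algebraMap (X.O Q) X.K g = κ.f⁻¹) :
    kricheverFlag κ (Fin.last n) = κ.image := by
  by_contra hne
  obtain ⟨h1, h2⟩ := κ.isFredholm_image hP hred
  have h := virtDim_lt (isFredholm_kricheverFlag κ hP hPQ hred hfQ _) h1
    ((kricheverFlag_last_le κ hP hPQ hred hfQ).lt_of_ne hne)
  rw [virtDim_kricheverFlag κ hP hPQ hred hfQ, h2, Fin.val_last] at h
  lia

theorem kricheverFlag_mem_affineFlag (hP : X.IsSmoothPt P) (hPQ : P ≠ Q)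
    (hred : κ.image.map (tPow (-n)) ≤ κ.image)
    (hfQ : ∃ g ∈ IsLocalRing.maximalIdeal (X.O Q), algebraMap (X.O Q) X.K g = κ.f⁻¹) :
    kricheverFlag κ ∈ AffineFlag n := by
  have hmono := (kricheverFlag_strictMono κ hP hPQ hred).monotone
  have hlast := kricheverFlag_last κ hP hPQ hred hfQ
  refine ⟨hmono, fun i => ⟨⟨isFredholm_kricheverFlag κ hP hPQ hred hfQ i, ?_⟩,
    virtDim_kricheverFlag κ hP hPQ hred hfQ i⟩, by rw [hlast, kricheverFlag_zero]⟩
  refine (Submodule.map_mono (hmono (Fin.le_last i))).trans ?_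
  rw [hlast, ← kricheverFlag_zero]
  exact hmono (Fin.zero_le i)

/-- The map `F_n → E'_n / E'_0` taking `t ^ (-n) φ(v)` to the class of `v` is surjective with kernel
`F_0`. -/
theorem inducesFlag_kricheverFlag (hP : X.IsSmoothPt P) (hPQ : P ≠ Q)
    (hred : κ.image.map (tPow (-n)) ≤ κ.image) : InducesFlag M κ (kricheverFlag κ) := by
  let S := (M.E' (Fin.last n)).sectionsAway P
  let B := (M.E' (Fin.last n)).fibre Q
  let B₀ := ((M.E' 0).fibre Q).submoduleOf B
  let F := kricheverFlag κ
  have hSB : S ≤ B := fun v hv => ((M.mem_sectionsAway' hPQ).mp hv).1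
  have hsec := (sectionsAway_strictMono κ hP hPQ hred).monotone
  let e : S ≃ₗ[ℂ] F (Fin.last n) :=
    S.equivMapOfInjective (tPow (-n) ∘ₗ κ.φ) (injective_tPow_comp κ hP)
  let ν : F (Fin.last n) →ₗ[ℂ] ↥B ⧸ B₀ := B₀.mkQ ∘ₗ Submodule.inclusion hSB ∘ₗ e.symm.toLinearMap
  have hν : ∀ v : S, ν (e v) = B₀.mkQ (Submodule.inclusion hSB v) := fun v => by simp [ν]
  have hker : (F 0).submoduleOf (F (Fin.last n)) = LinearMap.ker ν := by
    ext g
    obtain ⟨v, rfl⟩ := e.surjective g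
    rw [LinearMap.mem_ker, hν]
    refine Iff.trans ?_ (Submodule.Quotient.mk_eq_zero B₀).symm
    constructor
    · rintro ⟨w, hw, hwv⟩
      have : w = v := injective_tPow_comp κ hP hwv
      rw [this] at hw
      exact ((M.mem_sectionsAway' hPQ).mp hw).1
    · intro h
      exact ⟨v, (M.mem_sectionsAway' hPQ).mpr ⟨h, ((M.mem_sectionsAway' hPQ).mp v.2).2⟩, rfl⟩
  have hsurj : Function.Surjective ν := by
    intro q
    obtain ⟨⟨b, hb⟩, rfl⟩ := B₀.mkQ_surjective q
    obtain ⟨w, hw, hbw⟩ := exists_mem_sectionsAway_sub_mem κ hP hPQ hred hb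
    refine ⟨e ⟨w, hw⟩, ?_⟩
    rw [hν, eq_comm, ← sub_eq_zero]
    exact (Submodule.Quotient.mk_eq_zero B₀).mpr hbw
  let θ := Submodule.quotEquivOfEq _ _ hker ≪≫ₗ ν.quotKerEquivOfSurjective hsurj
  have hθ : ∀ g, θ (Submodule.Quotient.mk g) = ν g := fun g => rfl
  refine ⟨θ, fun v hv => ⟨⟨v, hv, rfl⟩, hSB hv, (hθ _).trans (hν ⟨v, hv⟩)⟩, fun i => ?_⟩
  ext q
  constructor
  · rintro ⟨_, ⟨g, ⟨v, hv, hvg⟩, rfl⟩, rfl⟩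
    have hvS : v ∈ S := hsec (Fin.le_last i) hv
    have hg : g = e ⟨v, hvS⟩ := Subtype.ext hvg.symm
    refine ⟨⟨v, hSB hvS⟩, ((M.mem_sectionsAway' hPQ).mp hv).1, ?_⟩
    rw [hg]
    exact ((hθ _).trans (hν ⟨v, hvS⟩)).symm
  · rintro ⟨⟨b, hb⟩, hbi, rfl⟩
    obtain ⟨w, hw, hbw⟩ := exists_mem_sectionsAway_sub_mem κ hP hPQ hred
      (show b ∈ (M.E' i).fibre Q from hbi)
    have hwS : w ∈ S := hsec (Fin.le_last i) hw
    refine ⟨Submodule.Quotient.mk (e ⟨w, hwS⟩), Submodule.mem_map_of_mem ⟨w, hw, rfl⟩, ?_⟩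
    refine ((hθ _).trans (hν ⟨w, hwS⟩)).trans ?_
    rw [eq_comm, ← sub_eq_zero]
    exact (Submodule.Quotient.mk_eq_zero B₀).mpr hbw

theorem mk_mem_imageInQuot {V : Type} [AddCommGroup V] [Module ℂ V] {A₀ A B : Submodule ℂ V}
    (h : A₀ ≤ A) (b : B) :
    Submodule.Quotient.mk b ∈ imageInQuot A₀ A B ↔ (b : V) ∈ A := by
  constructor
  · rintro ⟨a, ha, hab⟩
    have h1 := h ((Submodule.Quotient.eq (A₀.submoduleOf B)).mp hab)
    have h2 := sub_mem (show (a : V) ∈ A from ha) h1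
    simpa using h2
  · exact fun hb => Submodule.mem_map_of_mem hb

/-- A chain which induces the flag at `Q` and ends with `F_n = t ^ (-n) φ(H⁰(X ∖ P, E'_n))` is
determined by it. -/
theorem InducesFlag.eq_kricheverFlag (hPQ : P ≠ Q) {F : Fin (n + 1) → Submodule ℂ Laurent}
    (hF : Monotone F) (hlast : F (Fin.last n) = kricheverFlag κ (Fin.last n))
    (h : InducesFlag M κ F) : F = kricheverFlag κ := by
  obtain ⟨θ, hθ, hflag⟩ := h
  have key : ∀ i, ∀ v ∈ (M.E' (Fin.last n)).sectionsAway P,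
      tPow (-n) (κ.φ v) ∈ F i ↔ v ∈ (M.E' i).fibre Q := by
    intro i v hv
    obtain ⟨h1, h2, h3⟩ := hθ v hv
    rw [← mk_mem_imageInQuot (hF (Fin.zero_le i)) ⟨_, h1⟩,
      ← mk_mem_imageInQuot (M.strictMono_fibre.monotone (Fin.zero_le i)) ⟨v, h2⟩, ← hflag i, ← h3]
    rw [Submodule.mem_map_equiv, LinearEquiv.symm_apply_apply]
  funext i
  ext g
  constructor
  · intro hg
    obtain ⟨v, hv, rfl⟩ := hlast ▸ hF (Fin.le_last i) hg
    exact ⟨v, (M.mem_sectionsAway' hPQ).mpr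
      ⟨(key i v hv).mp hg, ((M.mem_sectionsAway' hPQ).mp hv).2⟩, rfl⟩
  · rintro ⟨v, hv, rfl⟩
    obtain ⟨h1, h2⟩ := (M.mem_sectionsAway' hPQ).mp hv
    exact (key i v ((M.mem_sectionsAway' hPQ).mpr
      ⟨M.strictMono_fibre.monotone (Fin.le_last i) h1, h2⟩)).mpr h1

end Flag

end AffineMiura

end

theorem mainTheorem2 (X : AffineMiura.CompleteCurve) (P Q : X.Pt) (hPQ : P ≠ Q)
    (hP : X.IsSmoothPt P) (hQ : X.IsSmoothPt Q) (n : ℕ)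
    (M : AffineMiura.LocalAffineMiuraOper X P Q n)
    (κ : AffineMiura.KricheverTrivialization M.toLocalAffineOper)
    (hred : κ.image.map (AffineMiura.tPow (-n)) ≤ κ.image)
    (hfQ : ∃ g ∈ IsLocalRing.maximalIdeal (X.O Q), algebraMap (X.O Q) X.K g = κ.f⁻¹) :
    κ.image ∈ AffineMiura.ReducedGr n ∧
      ∃! F : Fin (n + 1) → Submodule ℂ AffineMiura.Laurent,
        F ∈ AffineMiura.AffineFlag n ∧ F (Fin.last n) = κ.image ∧
          AffineMiura.InducesFlag M κ F := by
  have hlast := AffineMiura.kricheverFlag_last κ hP hPQ hred hfQ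
  refine ⟨⟨(κ.isFredholm_image hP hred).1, hred⟩, AffineMiura.kricheverFlag κ,
    ⟨AffineMiura.kricheverFlag_mem_affineFlag κ hP hPQ hred hfQ, hlast,
      AffineMiura.inducesFlag_kricheverFlag κ hP hPQ hred⟩, fun F hF => ?_⟩
  exact hF.2.2.eq_kricheverFlag κ hPQ hF.1.1 (hF.2.1.trans hlast.symm)
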